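/- Let $X=U\Sigma V^*$ and $X_l=U_l\Sigma_lV_l^*$ be two fixed real $n\times n$ matrices of rank $r$, with reduced singular value decompositions as written. For a matrix $W$ with orthonormal columns let $\mathcal P_W$ denote the orthogonal projection of $\mathbb R^n$ onto the column space of $W$; thus $\mathcal P_U,\mathcal P_V$ are the projections onto the column space and the row space of $X$, and likewise for $X_l$. Assume that both matrices are $\mu$-incoherent with $\mu>0$, that is, for $1\le i,j\le n$, $$\|\mathcal P_{U_l}(e_i)\|\le\sqrt{\frac{\mu r}{n}},\quad \|\mathcal P_{V_l}(e_j)\|\le\sqrt{\frac{\mu r}{n}},\quad \|\mathcal P_{U}(e_i)\|\le\sqrt{\frac{\mu r}{n}},\quad \|\mathcal P_{V}(e_j)\|\le\sqrt{\frac{\mu r}{n}},$$ where $e_1,\dots,e_n$ is the canonical basis of $\mathbb R^n$ and $\|\cdot\|$ is the Euclidean norm. Equip $\mathbb R^{n\times n}$ with the Frobenius inner product. On matrices, let $\mathcal P_U$ and $\mathcal P_{U_l}$ act column by column, $\mathcal P_U(Z)=UU^*Z$ and $\mathcal P_{U_l}(Z)=U_lU_l^*Z$, and let $\mathcal P_{T_l}$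 be the orthogonal projection onto the tangent space $$T_l=\{U_lZ_1^*+Z_2V_l^*:\ Z_1,Z_2\in\mathbb R^{n\times r}\}.$$ Let $\Omega=((i_k,j_k))_{k=1}^m$, $m\ge1$, be indices sampled independently from the uniform distribution on $\{1,\dots,n\}\times\{1,\dots,n\}$ (with replacement), and let $\mathcal P_\Omega$ map a matrix to its entrywise product with $\sum_{k=1}^m e_{i_k}e_{j_k}^*$. Then, for every $\beta>1$, if $m\ge 15\beta\mu nr\log(n)$, the inequality $$\left\|\frac{n^2}{m}\mathcal P_{T_l}\mathcal P_\Omega(\mathcal P_U-\mathcal P_{U_l})-\mathcal P_{T_l}(\mathcal P_U-\mathcal P_{U_l})\right\|\le\sqrt{\frac{48\beta\mu nr\log(n)}{m}}$$ holds with probability at least $1-2n^{2-2\beta}$, where the norm on the left is the spectral norm of a linear operator on $\mathbb R^{n\times n}$ with the Frobenius norm. -/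

import Mathlib

open MeasureTheory ProbabilityTheory

noncomputable section

namespace MatrixCompletion

/-- `X = U diag(σ) Vᵀ` is a reduced singular value decomposition with `r` (positive) singular
values; the columns of `U` and of `V` are orthonormal. -/
structure IsReducedSVD {n r : ℕ} (X : Matrix (Fin n) (Fin n) ℝ)
    (U : Matrix (Fin n) (Fin r) ℝ) (σ : Fin r → ℝ) (V : Matrix (Fin n) (Fin r) ℝ) : Prop where
  left_orthonormal : U.transpose * U = 1
  right_orthonormal : V.transpose * V = 1
  pos : ∀ k, 0 < σ k
  eq : X = U * Matrix.diagonal σ * V.transpose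

/-- The column space of a matrix, inside Euclidean space. -/
def colSpace {n k : ℕ} (A : Matrix (Fin n) (Fin k) ℝ) : Submodule ℝ (EuclideanSpace ℝ (Fin n)) :=
  LinearMap.range (Matrix.toEuclideanLin A)

/-- The orthogonal projection `P_U` of `ℝⁿ` onto the column space of `U`.
If `X = U Σ Vᵀ` is a reduced SVD, then `P_U` and `P_V` are the orthogonal projections onto the
column space and the row space of `X` (see `IsReducedSVD.colSpace_eq` and
`IsReducedSVD.rowSpace_eq`). -/
def vecProj {n k : ℕ} (U : Matrix (Fin n) (Fin k) ℝ) :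
    EuclideanSpace ℝ (Fin n) →L[ℝ] EuclideanSpace ℝ (Fin n) :=
  (colSpace U).starProjection

/-- `‖P_U e_i‖ ≤ √(μ r / n)` and `‖P_V e_j‖ ≤ √(μ r / n)` for all `i`, `j`: the matrix with singular
vectors `U`, `V` is `μ`-incoherent. -/
def IsIncoherent {n r : ℕ} (μ : ℝ) (U V : Matrix (Fin n) (Fin r) ℝ) : Prop :=
  (∀ i, ‖vecProj U (EuclideanSpace.single i 1)‖ ≤ √(μ * r / n)) ∧
    (∀ j, ‖vecProj V (EuclideanSpace.single j 1)‖ ≤ √(μ * r / n))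

/-- The space of real `n × n` matrices with the Frobenius inner product and norm. -/
abbrev FrobMat (n : ℕ) : Type := EuclideanSpace ℝ (Fin n × Fin n)

/-- The entrywise identification of `FrobMat n` with the `n × n` matrices. -/
def frobEquiv (n : ℕ) : FrobMat n ≃ₗ[ℝ] Matrix (Fin n) (Fin n) ℝ where
  toFun Z := Matrix.of fun i j => Z (i, j)
  invFun A := WithLp.toLp 2 fun p => A p.1 p.2
  map_add' _ _ := rfl
  map_smul' _ _ := rfl
  left_inv _ := rfl
  right_inv _ := rfl

/-- A linear map of matrices as an operator for the Frobenius norm. Its norm as a continuous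
linear map is the spectral norm of the operator. -/
def frobOp {n : ℕ} (f : Matrix (Fin n) (Fin n) ℝ →ₗ[ℝ] Matrix (Fin n) (Fin n) ℝ) :
    FrobMat n →L[ℝ] FrobMat n :=
  LinearMap.toContinuousLinearMap
    ((frobEquiv n).symm.toLinearMap ∘ₗ f ∘ₗ (frobEquiv n).toLinearMap)

/-- The operator `P_U` on matrices, which projects every column of a matrix onto the column
space of `U` (so that `P_U Z = U Uᵀ Z` if `U` has orthonormal columns). -/
def colProjOp {n k : ℕ} (U : Matrix (Fin n) (Fin k) ℝ) : FrobMat n →L[ℝ] FrobMat n :=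
  frobOp
    { toFun := fun Z => Matrix.of fun i j => vecProj U (WithLp.toLp 2 (fun i' => Z i' j)) i
      map_add' := fun A B => by
        ext i j
        have h : (WithLp.toLp 2 (fun i' => (A + B) i' j) : EuclideanSpace ℝ (Fin n)) =
          WithLp.toLp 2 (fun i' => A i' j) + WithLp.toLp 2 (fun i' => B i' j) := rfl
        simp only [Matrix.of_apply, Matrix.add_apply] at h ⊢
        rw [h, map_add]
        rfl
      map_smul' := fun c A => by
        ext i j
        have h : (WithLp.toLp 2 (fun i' => (c • A) i' j) : EuclideanSpace ℝ (Fin n)) =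
          c • WithLp.toLp 2 (fun i' => A i' j) := rfl
        simp only [Matrix.of_apply, Matrix.smul_apply, RingHom.id_apply] at h ⊢
        rw [h, map_smul]
        rfl }

/-- The tangent space `{U Z₁ᵀ + Z₂ Vᵀ : Z₁, Z₂ ∈ ℝ^{n × r}}` of the manifold of rank `r` matrices at
a matrix with singular vectors `U`, `V`. -/
def tangentSpace {n r : ℕ} (U V : Matrix (Fin n) (Fin r) ℝ) : Submodule ℝ (FrobMat n) where
  carrier := {W | ∃ Z₁ Z₂ : Matrix (Fin n) (Fin r) ℝ,
    frobEquiv n W = U * Z₁.transpose + Z₂ * V.transpose}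
  zero_mem' := ⟨0, 0, by simp⟩
  add_mem' := by
    rintro W W' ⟨A, B, h⟩ ⟨A', B', h'⟩
    refine ⟨A + A', B + B', ?_⟩
    rw [map_add, h, h', Matrix.transpose_add, Matrix.mul_add, Matrix.add_mul]
    abel
  smul_mem' := by
    rintro c W ⟨A, B, h⟩
    refine ⟨c • A, c • B, ?_⟩
    rw [map_smul, h, Matrix.transpose_smul, Matrix.mul_smul, Matrix.smul_mul, smul_add]

/-- The operator `P_T` on matrices: the orthogonal projection, for the Frobenius inner product,
onto the tangent space at a matrix with singular vectors `U`, `V`. -/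
def tangentProj {n r : ℕ} (U V : Matrix (Fin n) (Fin r) ℝ) : FrobMat n →L[ℝ] FrobMat n :=
  (tangentSpace U V).starProjection

/-- The sampling operator `P_Ω` of the list of indices `Ω = (ω 1, …, ω m)`, repetitions counted:
the entrywise product with the matrix `∑ k, e_{i_k} e_{j_k}ᵀ`, where `ω k = (i_k, j_k)`. -/
def sampling {n m : ℕ} (ω : Fin m → Fin n × Fin n) : FrobMat n →L[ℝ] FrobMat n :=
  frobOp
    { toFun := fun Z => Matrix.hadamard Z (∑ k, Matrix.single (ω k).1 (ω k).2 (1 : ℝ))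
      map_add' := fun A B => Matrix.add_hadamard _ A B
      map_smul' := fun c A => Matrix.smul_hadamard A _ c }

/-- `ω 1, …, ω m` are independent random indices, each uniformly distributed on
`{1, …, n} × {1, …, n}`. -/
structure IsUniformSample {S : Type*} [MeasurableSpace S] (P : Measure S) {n m : ℕ}
    (ω : Fin m → S → Fin n × Fin n) : Prop where
  measurable : ∀ k, Measurable (ω k)
  indep : iIndepFun ω P
  uniform : ∀ k, P.map (ω k) = uniformOn Set.univ

theorem IsReducedSVD.transpose {n r : ℕ} {X : Matrix (Fin n) (Fin n) ℝ}
    {U V : Matrix (Fin n) (Fin r) ℝ} {σ : Fin r → ℝ} (h : IsReducedSVD X U σ V) :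
    IsReducedSVD X.transpose V σ U :=
  ⟨h.right_orthonormal, h.left_orthonormal, h.pos, by
    rw [h.eq, Matrix.transpose_mul, Matrix.transpose_mul, Matrix.transpose_transpose,
      Matrix.diagonal_transpose, Matrix.mul_assoc]⟩

theorem IsReducedSVD.colSpace_eq {n r : ℕ} {X : Matrix (Fin n) (Fin n) ℝ}
    {U V : Matrix (Fin n) (Fin r) ℝ} {σ : Fin r → ℝ} (h : IsReducedSVD X U σ V) :
    colSpace X = colSpace U := by
  have hU : U = X * (V * Matrix.diagonal (fun k => (σ k)⁻¹)) := by
    have hd : Matrix.diagonal σ * Matrix.diagonal (fun k => (σ k)⁻¹) = 1 := by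
      rw [Matrix.diagonal_mul_diagonal, ← Matrix.diagonal_one]
      congr 1
      funext k
      exact mul_inv_cancel₀ (h.pos k).ne'
    rw [h.eq, Matrix.mul_assoc (U * Matrix.diagonal σ), ← Matrix.mul_assoc V.transpose,
      h.right_orthonormal, Matrix.one_mul, Matrix.mul_assoc, hd, Matrix.mul_one]
  apply le_antisymm
  · rintro _ ⟨x, rfl⟩
    refine ⟨WithLp.toLp 2 ((Matrix.diagonal σ * V.transpose).mulVec x.ofLp), ?_⟩
    rw [Matrix.toLpLin_apply, Matrix.toLpLin_apply, h.eq, Matrix.mulVec_mulVec,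
      Matrix.mul_assoc]
  · rintro _ ⟨x, rfl⟩
    refine ⟨WithLp.toLp 2 ((V * Matrix.diagonal (fun k => (σ k)⁻¹)).mulVec x.ofLp), ?_⟩
    rw [Matrix.toLpLin_apply, Matrix.toLpLin_apply, Matrix.mulVec_mulVec, ← hU]

theorem IsReducedSVD.rowSpace_eq {n r : ℕ} {X : Matrix (Fin n) (Fin n) ℝ}
    {U V : Matrix (Fin n) (Fin r) ℝ} {σ : Fin r → ℝ} (h : IsReducedSVD X U σ V) :
    colSpace X.transpose = colSpace V :=
  h.transpose.colSpace_eq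

theorem IsReducedSVD.rank_eq {n r : ℕ} {X : Matrix (Fin n) (Fin n) ℝ}
    {U V : Matrix (Fin n) (Fin r) ℝ} {σ : Fin r → ℝ} (h : IsReducedSVD X U σ V) :
    X.rank = r := by
  apply le_antisymm
  · rw [h.eq, Matrix.mul_assoc]
    exact (Matrix.rank_mul_le_left _ _).trans ((Matrix.rank_le_width U))
  · have hd : U.transpose * X * V = Matrix.diagonal σ := by
      rw [h.eq]
      calc U.transpose * (U * Matrix.diagonal σ * V.transpose) * V
          = (U.transpose * U) * Matrix.diagonal σ * (V.transpose * V) := by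
            simp only [Matrix.mul_assoc]
        _ = Matrix.diagonal σ := by
            rw [h.left_orthonormal, h.right_orthonormal, Matrix.one_mul, Matrix.mul_one]
    have hr : (Matrix.diagonal σ).rank = r := by
      have hu : IsUnit (Matrix.diagonal σ) := by
        rw [Matrix.isUnit_iff_isUnit_det, Matrix.det_diagonal, isUnit_iff_ne_zero]
        exact Finset.prod_ne_zero_iff.mpr fun k _ => (h.pos k).ne'
      rw [Matrix.rank_of_isUnit _ hu, Fintype.card_fin]
    calc r = (U.transpose * X * V).rank := by rw [hd, hr]
      _ ≤ (U.transpose * X).rank := Matrix.rank_mul_le_left _ _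
      _ ≤ X.rank := Matrix.rank_mul_le_right _ _

end MatrixCompletion

end

/-
Let `A = P_{T_l}` and `B = P_U - P_{U_l}`. The error `(n² / m) A P_Ω B - A B` is the average of
`m` independent copies of the centred rank one operator `n² (A e_p) (B e_p)ᵀ - A B`, where `p` is a
uniformly distributed entry and `e_p` the corresponding matrix unit. Incoherence gives
`‖A e_p‖² ≤ 2 μ r / n` and `‖B e_p‖² ≤ 4 μ r / n`, and `‖A‖, ‖B‖ ≤ 1`; hence the norm of one copy
and both of its variances (row and column) are at most `6 μ n r`, and the matrix Bernstein
inequality bounds the probability that the error exceeds `τ ≤ 2` by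
`2 n² exp (-m τ² / (24 μ n r))`.

Bernstein's inequality is Ahlswede and Winter's: the Golden–Thompson inequality
`tr exp (X + Y) ≤ tr (exp X exp Y)` lets one peel off independent summands from
`E tr exp (∑ θ X_k)` one at a time, each costing a factor bounded by `exp (θ² v)` because
`exp x ≤ 1 + x + x²` for `x ≤ 1`. Golden–Thompson itself follows from the trace inequality
`tr (X Y)^(2^k) ≤ tr (X^(2^k) Y^(2^k))` for Hermitian `X`, `Y` and the Lie product formula.
-/

namespace MatrixCompletion

section LieProduct

open Filter Topology NormedSpace

variable {𝔸 : Type*} [NormedRing 𝔸]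

theorem norm_pow_succ_sub_pow_succ_le {X Y : 𝔸} {M : ℝ} (hX : ‖X‖ ≤ M) (hY : ‖Y‖ ≤ M) (N : ℕ) :
    ‖X ^ (N + 1) - Y ^ (N + 1)‖ ≤ (N + 1) * M ^ N * ‖X - Y‖ := by
  have hM : 0 ≤ M := (norm_nonneg X).trans hX
  induction N with
  | zero => simp
  | succ N ih =>
    have hY_pow : ‖Y ^ (N + 1)‖ ≤ M ^ (N + 1) :=
      (norm_pow_le' Y N.succ_pos).trans (pow_le_pow_left₀ (norm_nonneg Y) hY _)
    calc ‖X ^ (N + 1 + 1) - Y ^ (N + 1 + 1)‖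
        = ‖(X ^ (N + 1) - Y ^ (N + 1)) * X + Y ^ (N + 1) * (X - Y)‖ := by
          rw [pow_succ X, pow_succ Y]
          noncomm_ring
      _ ≤ ‖X ^ (N + 1) - Y ^ (N + 1)‖ * ‖X‖ + ‖Y ^ (N + 1)‖ * ‖X - Y‖ :=
          (norm_add_le _ _).trans (add_le_add (norm_mul_le _ _) (norm_mul_le _ _))
      _ ≤ (N + 1) * M ^ N * ‖X - Y‖ * M + M ^ (N + 1) * ‖X - Y‖ := by gcongr
      _ = ((N + 1 : ℕ) + 1) * M ^ (N + 1) * ‖X - Y‖ := by push_cast; ring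

variable [NormedAlgebra ℝ 𝔸]

theorem norm_exp_le_exp_norm [NormOneClass 𝔸] (Z : 𝔸) : ‖exp Z‖ ≤ Real.exp ‖Z‖ := by
  rw [exp_eq_tsum ℝ, Real.exp_eq_exp_ℝ]
  refine tsum_of_norm_bounded (exp_series_hasSum_exp' (𝕂 := ℝ) ‖Z‖) fun k => ?_
  rw [norm_smul, smul_eq_mul, Real.norm_of_nonneg (by positivity)]
  gcongr
  exact norm_pow_le Z k

variable [CompleteSpace 𝔸]

theorem exp_inv_smul_pow (Z : 𝔸) {N : ℕ} (hN : N ≠ 0) : exp ((N : ℝ)⁻¹ • Z) ^ N = exp Z := by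
  let _ : NormedAlgebra ℚ 𝔸 := NormedAlgebra.restrictScalars ℚ ℝ 𝔸
  rw [← exp_nsmul, ← Nat.cast_smul_eq_nsmul ℝ, smul_inv_smul₀ (Nat.cast_ne_zero.2 hN)]

theorem tendsto_smul_exp_mul_exp_sub_exp_add (A B : 𝔸) :
    Tendsto (fun N : ℕ => (N : ℝ) • (exp ((N : ℝ)⁻¹ • A) * exp ((N : ℝ)⁻¹ • B) -
      exp ((N : ℝ)⁻¹ • (A + B)))) atTop (𝓝 0) := by
  have hderiv :
      HasDerivAt (fun t : ℝ => exp (t • A) * exp (t • B) - exp (t • (A + B))) 0 0 := by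
    have h := ((hasDerivAt_exp_smul_const A (0 : ℝ)).mul
      (hasDerivAt_exp_smul_const B (0 : ℝ))).sub (hasDerivAt_exp_smul_const (A + B) (0 : ℝ))
    simpa only [zero_smul, exp_zero, one_mul, mul_one, sub_self] using! h
  have hinv : Tendsto (fun N : ℕ => (N : ℝ)⁻¹) atTop (𝓝[≠] 0) := by
    refine tendsto_nhdsWithin_iff.2 ⟨tendsto_inv_atTop_nhds_zero_nat, ?_⟩
    filter_upwards [eventually_gt_atTop 0] with N hN
    simpa using hN.ne'
  simpa [Function.comp_def] using hderiv.tendsto_slope_zero.comp hinv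

variable [NormOneClass 𝔸]

theorem norm_exp_mul_exp_pow_sub_exp_add_le (A B : 𝔸) {N : ℕ} (hN : N ≠ 0) :
    ‖(exp ((N : ℝ)⁻¹ • A) * exp ((N : ℝ)⁻¹ • B)) ^ N - exp (A + B)‖ ≤
      ‖(N : ℝ) • (exp ((N : ℝ)⁻¹ • A) * exp ((N : ℝ)⁻¹ • B) - exp ((N : ℝ)⁻¹ • (A + B)))‖ *
        Real.exp (‖A‖ + ‖B‖) := by
  obtain ⟨N, rfl⟩ := Nat.exists_eq_succ_of_ne_zero hN
  set c : ℝ := ((N + 1 : ℕ) : ℝ)⁻¹ with hc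
  have hc0 : 0 ≤ c := by positivity
  have norm_smul_c (Z : 𝔸) : ‖c • Z‖ = c * ‖Z‖ := norm_smul_of_nonneg hc0 Z
  set M := Real.exp (c * (‖A‖ + ‖B‖)) with hM
  have hprod : ‖exp (c • A) * exp (c • B)‖ ≤ M := by
    rw [hM, mul_add, Real.exp_add, ← norm_smul_c, ← norm_smul_c]
    exact (norm_mul_le _ _).trans
      (mul_le_mul (norm_exp_le_exp_norm _) (norm_exp_le_exp_norm _) (norm_nonneg _)
        (Real.exp_pos _).le)
  have hsum : ‖exp (c • (A + B))‖ ≤ M := by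
    refine (norm_exp_le_exp_norm _).trans (Real.exp_le_exp.2 ?_)
    rw [norm_smul_c]
    gcongr
    exact norm_add_le A B
  have hpow : M ^ N ≤ Real.exp (‖A‖ + ‖B‖) := by
    rw [hM, ← Real.exp_nat_mul, ← mul_assoc]
    refine Real.exp_le_exp.2 (mul_le_of_le_one_left (by positivity) ?_)
    rw [hc, ← div_eq_mul_inv, div_le_one (by positivity)]
    exact_mod_cast N.le_succ
  rw [← exp_inv_smul_pow (A + B) hN, norm_smul, Real.norm_natCast]
  refine (norm_pow_succ_sub_pow_succ_le hprod hsum N).trans ?_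
  rw [mul_right_comm, ← Nat.cast_succ]
  gcongr

theorem tendsto_exp_mul_exp_pow (A B : 𝔸) :
    Tendsto (fun N : ℕ => (exp ((N : ℝ)⁻¹ • A) * exp ((N : ℝ)⁻¹ • B)) ^ N) atTop
      (𝓝 (exp (A + B))) := by
  rw [tendsto_iff_norm_sub_tendsto_zero]
  have hlim := (tendsto_smul_exp_mul_exp_sub_exp_add A B).norm.mul_const (Real.exp (‖A‖ + ‖B‖))
  rw [norm_zero, zero_mul] at hlim
  refine squeeze_zero' (Eventually.of_forall fun _ => norm_nonneg _) ?_ hlim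
  filter_upwards [eventually_ne_atTop 0] with N hN
  exact norm_exp_mul_exp_pow_sub_exp_add_le A B hN

end LieProduct

section GoldenThompson

open Matrix Filter Topology NormedSpace
open scoped ComplexOrder

variable {𝕜 J : Type*} [RCLike 𝕜] [Fintype J]

theorem two_mul_re_trace_mul_le (A B : Matrix J J 𝕜) :
    2 * RCLike.re (A * B).trace ≤ RCLike.re (A * Aᴴ).trace + RCLike.re (Bᴴ * B).trace := by
  have hnonneg := (RCLike.le_iff_re_im.1
    (posSemidef_self_mul_conjTranspose (A - Bᴴ)).trace_nonneg).1
  have hconj : RCLike.re (Bᴴ * Aᴴ).trace = RCLike.re (A * B).trace := by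
    rw [← conjTranspose_mul, trace_conjTranspose, RCLike.star_def, RCLike.conj_re]
  simp only [conjTranspose_sub, conjTranspose_conjTranspose, Matrix.sub_mul, Matrix.mul_sub,
    trace_sub, map_sub, map_zero, hconj] at hnonneg
  linarith

variable [DecidableEq J]

theorem trace_mul_pow_comm {R : Type*} [CommSemiring R] (A B : Matrix J J R) (k : ℕ) :
    ((A * B) ^ k).trace = ((B * A) ^ k).trace := by
  cases k with
  | zero => simp
  | succ k => rw [pow_succ, ← mul_assoc, mul_pow_mul, mul_assoc, trace_mul_comm, mul_assoc,
      ← pow_succ]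

theorem re_trace_pow_two_pow_le (k : ℕ) :
    (∀ X : Matrix J J 𝕜,
      RCLike.re (X ^ 2 ^ (k + 1)).trace ≤ RCLike.re ((X * Xᴴ) ^ 2 ^ k).trace) ∧
    (∀ A B : Matrix J J 𝕜, A.IsHermitian → B.IsHermitian →
      RCLike.re ((A * B) ^ 2 ^ k).trace ≤ RCLike.re (A ^ 2 ^ k * B ^ 2 ^ k).trace) := by
  induction k with
  | zero =>
    refine ⟨fun X => ?_, fun A B _ _ => by simp⟩
    have h := two_mul_re_trace_mul_le X X
    rw [trace_mul_comm Xᴴ X] at h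
    simp only [zero_add, pow_one, pow_zero, pow_two]
    linarith
  | succ k ih =>
    obtain ⟨ih_star, ih_mul⟩ := ih
    constructor
    · intro X
      set P := Xᴴ * X
      set Q := X * Xᴴ with hQ
      have hP_herm : P.IsHermitian := isHermitian_conjTranspose_mul_self X
      have hQ_herm : Q.IsHermitian := isHermitian_mul_conjTranspose_self X
      have hcross : 2 * RCLike.re (P ^ 2 ^ k * Q ^ 2 ^ k).trace ≤
          2 * RCLike.re (Q ^ 2 ^ (k + 1)).trace := by
        have h := two_mul_re_trace_mul_le (P ^ 2 ^ k) (Q ^ 2 ^ k)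
        rw [(hP_herm.pow _).eq, (hQ_herm.pow _).eq, ← pow_add, ← pow_add, ← two_mul, ← pow_succ',
          trace_mul_pow_comm Xᴴ X, ← hQ] at h
        linarith
      calc RCLike.re (X ^ 2 ^ (k + 1 + 1)).trace
          = RCLike.re ((X ^ 2) ^ 2 ^ (k + 1)).trace := by rw [← pow_mul, pow_succ' 2 (k + 1)]
        _ ≤ RCLike.re ((X ^ 2 * (X ^ 2)ᴴ) ^ 2 ^ k).trace := ih_star _
        _ = RCLike.re ((P * Q) ^ 2 ^ k).trace := by
          rw [pow_two, conjTranspose_mul, mul_assoc, trace_mul_pow_comm, trace_mul_pow_comm P]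
          simp only [P, Q, mul_assoc]
        _ ≤ RCLike.re (P ^ 2 ^ k * Q ^ 2 ^ k).trace := ih_mul _ _ hP_herm hQ_herm
        _ ≤ RCLike.re (Q ^ 2 ^ (k + 1)).trace := by linarith
    · intro A B hA hB
      calc RCLike.re ((A * B) ^ 2 ^ (k + 1)).trace
          ≤ RCLike.re ((A * B * (A * B)ᴴ) ^ 2 ^ k).trace := ih_star _
        _ = RCLike.re ((A ^ 2 * B ^ 2) ^ 2 ^ k).trace := by
          rw [conjTranspose_mul, hA.eq, hB.eq, pow_two, pow_two, mul_assoc A, trace_mul_pow_comm,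
            trace_mul_pow_comm (A * A)]
          simp only [mul_assoc]
        _ ≤ RCLike.re ((A ^ 2) ^ 2 ^ k * (B ^ 2) ^ 2 ^ k).trace :=
          ih_mul _ _ (hA.pow 2) (hB.pow 2)
        _ = RCLike.re (A ^ 2 ^ (k + 1) * B ^ 2 ^ (k + 1)).trace := by
          rw [← pow_mul, ← pow_mul, ← pow_succ']

attribute [local instance] Matrix.linftyOpNormedRing Matrix.linftyOpNormedAlgebra in
theorem re_trace_exp_add_le {A B : Matrix J J 𝕜} (hA : A.IsHermitian) (hB : B.IsHermitian) :
    RCLike.re (exp (A + B)).trace ≤ RCLike.re (exp A * exp B).trace := by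
  cases isEmpty_or_nonempty J
  · simp [Matrix.trace]
  have hlim := (tendsto_exp_mul_exp_pow A B).comp
    (tendsto_pow_atTop_atTop_of_one_lt (one_lt_two : (1 : ℕ) < 2))
  have hcont : Continuous fun M : Matrix J J 𝕜 => RCLike.re M.trace :=
    RCLike.continuous_re.comp continuous_id.matrix_trace
  refine le_of_tendsto ((hcont.tendsto _).comp hlim) (Eventually.of_forall fun k => ?_)
  have hexp (Z : Matrix J J 𝕜) : exp (((2 ^ k : ℕ) : ℝ)⁻¹ • Z) ^ 2 ^ k = exp Z :=
    exp_inv_smul_pow Z (by positivity)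
  have h := (re_trace_pow_two_pow_le k).2 _ _ ((hA.smul (.all (((2 ^ k : ℕ) : ℝ)⁻¹))).exp)
    ((hB.smul (.all (((2 ^ k : ℕ) : ℝ)⁻¹))).exp)
  rwa [hexp, hexp] at h

end GoldenThompson

section LoewnerOrder

open Matrix NormedSpace
open scoped MatrixOrder ComplexOrder

theorem real_exp_le_one_add_add_sq {x : ℝ} (hx : x ≤ 1) : Real.exp x ≤ 1 + x + x ^ 2 := by
  rcases le_total (-1) x with h | h
  · linarith [(abs_le.1 (Real.abs_exp_sub_one_sub_id_le (abs_le.2 ⟨h, hx⟩))).2]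
  · nlinarith [Real.exp_le_one_iff.2 (h.trans (by norm_num : (-1 : ℝ) ≤ 0))]

section ContinuousFunctionalCalculus

variable {A : Type*} [NormedRing A] [StarRing A] [NormedAlgebra ℝ A] [PartialOrder A]
  [StarOrderedRing A] [NonnegSpectrumClass ℝ A]

theorem exp_le_one_add_add_sq [ContinuousFunctionalCalculus ℝ A IsSelfAdjoint] {a : A}
    (ha : IsSelfAdjoint a) (ha_le : a ≤ 1) : exp a ≤ 1 + a + a ^ 2 := by
  have hspec : ∀ x ∈ spectrum ℝ a, x ≤ 1 := by
    rwa [← le_algebraMap_iff_spectrum_le (r := (1 : ℝ)), map_one]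
  calc exp a = cfc Real.exp a := (CFC.real_exp_eq_normedSpace_exp ha).symm
    _ ≤ cfc (fun x : ℝ => 1 + x + x ^ 2) a :=
      cfc_mono fun x hx => real_exp_le_one_add_add_sq (hspec x hx)
    _ = 1 + a + a ^ 2 := by
      rw [cfc_add .., cfc_add .., cfc_const_one ℝ a, cfc_id' ℝ a, cfc_pow_id a]

theorem norm_le_iff_neg_smul_one_le_and_le_smul_one
    [IsometricContinuousFunctionalCalculus ℝ A IsSelfAdjoint] {a : A} (ha : IsSelfAdjoint a)
    {r : ℝ} (hr : 0 ≤ r) : ‖a‖ ≤ r ↔ -(r • 1) ≤ a ∧ a ≤ r • 1 := by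
  rw [← Algebra.algebraMap_eq_smul_one, ← map_neg, algebraMap_le_iff_le_spectrum ha,
    le_algebraMap_iff_spectrum_le ha, ← forall₂_and]
  simpa only [cfc_id ℝ a, id, Real.norm_eq_abs, abs_le] using norm_cfc_le_iff (id : ℝ → ℝ) a hr

end ContinuousFunctionalCalculus

variable {J : Type*} [Fintype J]

theorem trace_mul_nonneg {𝕜 : Type*} [RCLike 𝕜] {A B : Matrix J J 𝕜} (hA : 0 ≤ A) (hB : 0 ≤ B) :
    0 ≤ (A * B).trace := by
  classical
  obtain ⟨C, rfl⟩ := CStarAlgebra.nonneg_iff_eq_star_mul_self.1 hA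
  rw [mul_assoc, trace_mul_comm]
  exact (nonneg_iff_posSemidef.1 (star_right_conjugate_nonneg hB C)).trace_nonneg

theorem trace_mul_le_trace_mul {𝕜 : Type*} [RCLike 𝕜] {A B C : Matrix J J 𝕜} (hA : 0 ≤ A)
    (hBC : B ≤ C) : (A * B).trace ≤ (A * C).trace := by
  rw [← sub_nonneg, ← trace_sub, ← mul_sub]
  exact trace_mul_nonneg hA (sub_nonneg.2 hBC)

variable [DecidableEq J]

theorem le_trace_of_mem_spectrum {B : Matrix J J ℝ} (hB : 0 ≤ B) {x : ℝ} (hx : x ∈ spectrum ℝ B) :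
    x ≤ B.trace := by
  have hpos := nonneg_iff_posSemidef.1 hB
  rw [hpos.isHermitian.spectrum_real_eq_range_eigenvalues] at hx
  obtain ⟨i, rfl⟩ := hx
  rw [hpos.isHermitian.trace_eq_sum_eigenvalues]
  exact Finset.single_le_sum (fun j _ => hpos.eigenvalues_nonneg j) (Finset.mem_univ i)

open scoped Matrix.Norms.L2Operator in
theorem exp_le_trace_exp_of_not_le {A : Matrix J J ℝ} (hA : IsSelfAdjoint A) {t : ℝ}
    (h : ¬ A ≤ t • 1) : Real.exp t ≤ (exp A).trace := by
  rw [← Algebra.algebraMap_eq_smul_one, le_algebraMap_iff_spectrum_le hA] at h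
  push Not at h
  obtain ⟨x, hx, htx⟩ := h
  have hexp_mem : Real.exp x ∈ spectrum ℝ (exp A) := by
    rw [← CFC.real_exp_eq_normedSpace_exp hA, cfc_map_spectrum ..]
    exact Set.mem_image_of_mem _ hx
  exact (Real.exp_le_exp.2 htx.le).trans (le_trace_of_mem_spectrum hA.exp_nonneg hexp_mem)

end LoewnerOrder

theorem integrable_comp_of_norm_le {E F S : Type*} [NormedAddCommGroup E] [NormedSpace ℝ E]
    [FiniteDimensional ℝ E] [MeasurableSpace E] [BorelSpace E] [NormedAddCommGroup F]
    [MeasurableSpace S] {P : Measure S} [IsFiniteMeasure P] {f : E → F} (hf : Continuous f)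
    {X : S → E} (hX : Measurable X) {R : ℝ} (hR : ∀ s, ‖X s‖ ≤ R) :
    Integrable (fun s => f (X s)) P := by
  have : ProperSpace E := FiniteDimensional.proper_real E
  obtain ⟨C, hC⟩ :=
    (isCompact_closedBall (0 : E) R).exists_bound_of_continuousOn hf.continuousOn
  exact .of_bound (hf.comp_aestronglyMeasurable hX.aestronglyMeasurable) C
    (ae_of_all _ fun s => hC _ (mem_closedBall_zero_iff.2 (hR s)))

section MatrixLaplaceTransform

open Matrix NormedSpace
open scoped MatrixOrder Matrix.Norms.L2Operator

variable {J : Type*}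

instance orderClosedTopology_matrix [Finite J] : OrderClosedTopology (Matrix J J ℝ) where
  isClosed_le' := by
    have := Fintype.ofFinite J
    refine isClosed_le_of_isClosed_nonneg ?_
    simp only [nonneg_iff_posSemidef, posSemidef_iff_dotProduct_mulVec, Set.ofPred_and,
      Set.ofPred_forall]
    exact (isClosed_eq (by fun_prop) continuous_id).inter
      (isClosed_iInter fun x => isClosed_le continuous_const (by fun_prop))

variable [Fintype J] [DecidableEq J]

theorem continuous_matrix_exp : Continuous (exp : Matrix J J ℝ → Matrix J J ℝ) :=
  let _ : NormedAlgebra ℚ (Matrix J J ℝ) := NormedAlgebra.restrictScalars ℚ ℝ _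
  exp_continuous

variable {S : Type*} [MeasurableSpace S] {P : Measure S}

theorem integral_trace {X : S → Matrix J J ℝ} (hX : Integrable X P) :
    ∫ s, (X s).trace ∂P = (∫ s, X s ∂P).trace :=
  (LinearMap.toContinuousLinearMap (traceLinearMap J ℝ ℝ)).integral_comp_comm hX

variable [MeasurableSpace (Matrix J J ℝ)] [BorelSpace (Matrix J J ℝ)]

theorem integral_trace_exp_add_le {X Y : S → Matrix J J ℝ} (hXY : IndepFun X Y P)
    (hX : ∀ s, IsSelfAdjoint (X s)) (hY : ∀ s, IsSelfAdjoint (Y s))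
    (hX_int : Integrable (fun s => exp (X s)) P) (hY_int : Integrable (fun s => exp (Y s)) P)
    {c : ℝ} (hc : ∫ s, exp (Y s) ∂P ≤ c • 1) :
    ∫ s, (exp (X s + Y s)).trace ∂P ≤ c * ∫ s, (exp (X s)).trace ∂P := by
  have hindep : IndepFun (fun s => exp (X s)) (fun s => exp (Y s)) P :=
    hXY.comp continuous_matrix_exp.measurable continuous_matrix_exp.measurable
  have hmul_int : Integrable (fun s => exp (X s) * exp (Y s)) P :=
    hindep.integrable_bilin hX_int hY_int (ContinuousLinearMap.mul ℝ (Matrix J J ℝ))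
  calc ∫ s, (exp (X s + Y s)).trace ∂P
      ≤ ∫ s, (exp (X s) * exp (Y s)).trace ∂P :=
        integral_mono_of_nonneg
          (ae_of_all _ fun s =>
            (nonneg_iff_posSemidef.1 ((hX s).add (hY s)).exp_nonneg).trace_nonneg)
          ((LinearMap.toContinuousLinearMap (traceLinearMap J ℝ ℝ)).integrable_comp hmul_int)
          (ae_of_all _ fun s => re_trace_exp_add_le (hX s) (hY s))
    _ = ((∫ s, exp (X s) ∂P) * ∫ s, exp (Y s) ∂P).trace := by
        rw [integral_trace hmul_int]
        exact congrArg trace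
          (hindep.integral_bilin hX_int hY_int (ContinuousLinearMap.mul ℝ (Matrix J J ℝ)))
    _ ≤ ((∫ s, exp (X s) ∂P) * c • 1).trace :=
        trace_mul_le_trace_mul (integral_nonneg fun s => (hX s).exp_nonneg) hc
    _ = c * ∫ s, (exp (X s)).trace ∂P := by
        rw [mul_smul_comm, mul_one, trace_smul, smul_eq_mul, integral_trace hX_int]

variable {ι : Type*} {Y : ι → S → Matrix J J ℝ}

theorem integral_trace_exp_sum_le (hindep : iIndepFun Y P) (hmeas : ∀ k, Measurable (Y k))
    (hself : ∀ k s, IsSelfAdjoint (Y k s)) {R : ℝ} (hR : ∀ k s, ‖Y k s‖ ≤ R) {c : ι → ℝ}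
    (hc_nonneg : ∀ k, 0 ≤ c k) (hc : ∀ k, ∫ s, exp (Y k s) ∂P ≤ c k • 1) (t : Finset ι) :
    ∫ s, (exp (∑ k ∈ t, Y k s)).trace ∂P ≤ Fintype.card J * ∏ k ∈ t, c k := by
  classical
  have : IsProbabilityMeasure P := hindep.isProbabilityMeasure
  induction t using Finset.induction_on with
  | empty => simp
  | insert i t hi ih =>
    have hsum_indep : IndepFun (fun s => ∑ k ∈ t, Y k s) (Y i) P := by
      simpa only [Finset.sum_fn] using hindep.indepFun_finsetSum_of_notMem hmeas hi
    have hsum_norm (s : S) : ‖∑ k ∈ t, Y k s‖ ≤ ∑ _ ∈ t, R := norm_sum_le_of_le t fun k _ => hR k s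
    calc ∫ s, (exp (∑ k ∈ insert i t, Y k s)).trace ∂P
        = ∫ s, (exp (∑ k ∈ t, Y k s + Y i s)).trace ∂P := by
          simp only [Finset.sum_insert hi, add_comm]
      _ ≤ c i * ∫ s, (exp (∑ k ∈ t, Y k s)).trace ∂P :=
          integral_trace_exp_add_le hsum_indep
            (fun s => isSelfAdjoint_sum _ fun k _ => hself k s) (hself i)
            (integrable_comp_of_norm_le continuous_matrix_exp
              (Finset.measurable_fun_sum t fun k _ => hmeas k) hsum_norm)
            (integrable_comp_of_norm_le continuous_matrix_exp (hmeas i) (hR i)) (hc i)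
      _ ≤ c i * (Fintype.card J * ∏ k ∈ t, c k) := mul_le_mul_of_nonneg_left ih (hc_nonneg i)
      _ = Fintype.card J * ∏ k ∈ insert i t, c k := by rw [Finset.prod_insert hi]; ring

variable [Fintype ι]

theorem measureReal_not_sum_le_le (hindep : iIndepFun Y P) (hmeas : ∀ k, Measurable (Y k))
    (hself : ∀ k s, IsSelfAdjoint (Y k s)) {R : ℝ} (hR : ∀ k s, ‖Y k s‖ ≤ R) {c : ι → ℝ}
    (hc_nonneg : ∀ k, 0 ≤ c k) (hc : ∀ k, ∫ s, exp (Y k s) ∂P ≤ c k • 1) (t : ℝ) :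
    P.real {s | ¬ ∑ k, Y k s ≤ t • 1} ≤ Fintype.card J * (∏ k, c k) * Real.exp (-t) := by
  have : IsProbabilityMeasure P := hindep.isProbabilityMeasure
  have hsum_self (s : S) : IsSelfAdjoint (∑ k, Y k s) := isSelfAdjoint_sum _ fun k _ => hself k s
  have htrace_int : Integrable (fun s => (exp (∑ k, Y k s)).trace) P :=
    (LinearMap.toContinuousLinearMap (traceLinearMap J ℝ ℝ)).integrable_comp <|
      integrable_comp_of_norm_le continuous_matrix_exp
        (Finset.measurable_fun_sum _ fun k _ => hmeas k)
        fun s => norm_sum_le_of_le _ fun k _ => hR k s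
  have hmarkov := mul_meas_ge_le_integral_of_nonneg
    (ae_of_all P fun s => (nonneg_iff_posSemidef.1 (hsum_self s).exp_nonneg).trace_nonneg)
    htrace_int (Real.exp t)
  rw [Real.exp_neg, ← div_eq_mul_inv, le_div_iff₀' (Real.exp_pos t)]
  calc Real.exp t * P.real {s | ¬ ∑ k, Y k s ≤ t • 1}
      ≤ Real.exp t * P.real {s | Real.exp t ≤ (exp (∑ k, Y k s)).trace} :=
        mul_le_mul_of_nonneg_left
          (measureReal_mono fun s => exp_le_trace_exp_of_not_le (hsum_self s)) (Real.exp_pos t).le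
    _ ≤ ∫ s, (exp (∑ k, Y k s)).trace ∂P := hmarkov
    _ ≤ Fintype.card J * ∏ k, c k :=
        integral_trace_exp_sum_le hindep hmeas hself hR hc_nonneg hc _

end MatrixLaplaceTransform

section MatrixBernstein

open Matrix NormedSpace
open scoped MatrixOrder Matrix.Norms.L2Operator

variable {J : Type*} [Fintype J] [DecidableEq J]
  [MeasurableSpace (Matrix J J ℝ)] [BorelSpace (Matrix J J ℝ)]
  {S : Type*} [MeasurableSpace S] {P : Measure S}

theorem integral_exp_smul_le [IsProbabilityMeasure P] {X : S → Matrix J J ℝ} (hmeas : Measurable X)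
    (hself : ∀ s, IsSelfAdjoint (X s)) (hmean : ∫ s, X s ∂P = 0) {L : ℝ} (hL : ∀ s, ‖X s‖ ≤ L)
    {v : ℝ} (hv : ∫ s, X s ^ 2 ∂P ≤ v • 1) {θ : ℝ} (hθ : 0 ≤ θ) (hθL : θ * L ≤ 1) :
    ∫ s, exp (θ • X s) ∂P ≤ Real.exp (θ ^ 2 * v) • 1 := by
  have hnorm (s : S) : ‖θ • X s‖ ≤ 1 := by
    rw [norm_smul, Real.norm_of_nonneg hθ]
    exact (mul_le_mul_of_nonneg_left (hL s) hθ).trans hθL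
  have hself_smul (s : S) : IsSelfAdjoint (θ • X s) := (IsSelfAdjoint.all θ).smul (hself s)
  have hX_int : Integrable X P := .of_bound hmeas.aestronglyMeasurable L (ae_of_all _ hL)
  have hsq_int : Integrable (fun s => X s ^ 2) P :=
    integrable_comp_of_norm_le (continuous_pow 2) hmeas hL
  have hsq_smul_int : Integrable (fun s => θ ^ 2 • X s ^ 2) P := hsq_int.fun_smul (θ ^ 2)
  have hlin_int : Integrable (fun s => 1 + θ • X s) P := (integrable_const _).add (hX_int.smul θ)
  calc ∫ s, exp (θ • X s) ∂P
      ≤ ∫ s, 1 + θ • X s + θ ^ 2 • X s ^ 2 ∂P := by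
        refine integral_mono
          (integrable_comp_of_norm_le continuous_matrix_exp (hmeas.const_smul θ) hnorm)
          (hlin_int.add hsq_smul_int) fun s => ?_
        have hle := ((norm_le_iff_neg_smul_one_le_and_le_smul_one (hself_smul s) zero_le_one).1
          (hnorm s)).2
        simpa only [smul_pow] using
          exp_le_one_add_add_sq (hself_smul s) (hle.trans_eq (one_smul ℝ 1))
    _ = 1 + θ ^ 2 • ∫ s, X s ^ 2 ∂P := by
        rw [integral_add hlin_int hsq_smul_int, integral_add (integrable_const _)
          (hX_int.fun_smul θ), integral_smul, integral_smul, hmean, smul_zero, add_zero,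
          integral_const, probReal_univ, one_smul]
    _ ≤ 1 + θ ^ 2 • v • 1 := by gcongr
    _ = (θ ^ 2 * v + 1) • 1 := by module
    _ ≤ Real.exp (θ ^ 2 * v) • 1 := smul_le_smul_of_nonneg_right (Real.add_one_le_exp _) zero_le_one

theorem measureReal_not_sum_le_le_exp {ι : Type*} [Fintype ι] {X : ι → S → Matrix J J ℝ}
    (hindep : iIndepFun X P) (hmeas : ∀ k, Measurable (X k))
    (hself : ∀ k s, IsSelfAdjoint (X k s)) (hmean : ∀ k, ∫ s, X k s ∂P = 0) {L : ℝ}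
    (hL : ∀ k s, ‖X k s‖ ≤ L) {v : ι → ℝ} (hv : ∀ k, ∫ s, X k s ^ 2 ∂P ≤ v k • 1)
    {θ : ℝ} (hθ : 0 < θ) (hθL : θ * L ≤ 1) (t : ℝ) :
    P.real {s | ¬ ∑ k, X k s ≤ t • 1} ≤
      Fintype.card J * Real.exp (θ ^ 2 * ∑ k, v k - θ * t) := by
  have : IsProbabilityMeasure P := hindep.isProbabilityMeasure
  have hscale (s : S) : ∑ k, θ • X k s ≤ (θ * t) • 1 ↔ ∑ k, X k s ≤ t • 1 := by
    rw [← Finset.smul_sum, mul_smul, smul_le_smul_iff_of_pos_left hθ]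
  calc P.real {s | ¬ ∑ k, X k s ≤ t • 1}
      = P.real {s | ¬ ∑ k, θ • X k s ≤ (θ * t) • 1} := by simp only [hscale]
    _ ≤ Fintype.card J * (∏ k, Real.exp (θ ^ 2 * v k)) * Real.exp (-(θ * t)) :=
        measureReal_not_sum_le_le (hindep.comp _ fun _ => measurable_const_smul θ)
          (fun k => (hmeas k).const_smul θ) (fun k s => (IsSelfAdjoint.all θ).smul (hself k s))
          (fun k s => (norm_smul_le θ _).trans (mul_le_mul_of_nonneg_left (hL k s) (norm_nonneg θ)))
          (fun k => (Real.exp_pos _).le)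
          (fun k => integral_exp_smul_le (hmeas k) (hself k) (hmean k) (hL k) (hv k) hθ.le hθL) _
    _ = Fintype.card J * Real.exp (θ ^ 2 * ∑ k, v k - θ * t) := by
        rw [← Real.exp_sum, mul_assoc, ← Real.exp_add, ← Finset.mul_sum, ← sub_eq_add_neg]

end MatrixBernstein

section Dilation

open Matrix
open scoped MatrixOrder Matrix.Norms.L2Operator

variable {I K : Type*}

/-- The self-adjoint dilation `[[0, M], [Mᴴ, 0]]` of a rectangular matrix. It reduces the operator
norm of arbitrary matrices to the Loewner order of self-adjoint ones. -/
def dilation : Matrix I K ℝ →ₗ[ℝ] Matrix (I ⊕ K) (I ⊕ K) ℝ where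
  toFun M := fromBlocks 0 M Mᴴ 0
  map_add' M N := by rw [conjTranspose_add, fromBlocks_add, add_zero, add_zero]
  map_smul' c M := by
    rw [conjTranspose_smul, star_trivial, RingHom.id_apply, fromBlocks_smul, smul_zero, smul_zero]

theorem dilation_apply (M : Matrix I K ℝ) : dilation M = fromBlocks 0 M Mᴴ 0 := rfl

theorem isSelfAdjoint_dilation (M : Matrix I K ℝ) : IsSelfAdjoint (dilation M) := by
  rw [dilation_apply, IsSelfAdjoint, star_eq_conjTranspose, fromBlocks_conjTranspose,
    conjTranspose_conjTranspose, conjTranspose_zero, conjTranspose_zero]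

theorem fromBlocks_diagonal_le_smul_one [Finite I] [Finite K] [DecidableEq I] [DecidableEq K]
    {A : Matrix I I ℝ} {D : Matrix K K ℝ} {v : ℝ} (hA : A ≤ v • 1) (hD : D ≤ v • 1) :
    fromBlocks A 0 0 D ≤ v • 1 := by
  have := Fintype.ofFinite I
  have := Fintype.ofFinite K
  obtain ⟨B, hB⟩ := CStarAlgebra.nonneg_iff_eq_star_mul_self.1 (sub_nonneg.2 hA)
  obtain ⟨C, hC⟩ := CStarAlgebra.nonneg_iff_eq_star_mul_self.1 (sub_nonneg.2 hD)
  have hsub : v • 1 - fromBlocks A 0 0 D = (fromBlocks B 0 0 C)ᴴ * fromBlocks B 0 0 C := by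
    rw [fromBlocks_conjTranspose, fromBlocks_multiply, ← fromBlocks_one, fromBlocks_smul,
      sub_eq_add_neg, fromBlocks_neg, fromBlocks_add]
    simp only [conjTranspose_zero, Matrix.zero_mul, Matrix.mul_zero, smul_zero, neg_zero, add_zero,
      zero_add, ← star_eq_conjTranspose, ← hB, ← hC, ← sub_eq_add_neg]
  rw [le_iff, hsub]
  exact posSemidef_conjTranspose_mul_self _

variable [Fintype I] [Fintype K] [DecidableEq K]

theorem conjTranspose_mul_self_le_smul_one_iff (M : Matrix I K ℝ) {t : ℝ} (ht : 0 ≤ t) :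
    Mᴴ * M ≤ t ^ 2 • 1 ↔ ‖M‖ ≤ t := by
  have hnonneg : 0 ≤ Mᴴ * M := nonneg_iff_posSemidef.2 (posSemidef_conjTranspose_mul_self M)
  have hneg : -(t ^ 2 • 1) ≤ Mᴴ * M :=
    (neg_nonpos.2 (smul_nonneg (sq_nonneg t) zero_le_one)).trans hnonneg
  have := norm_le_iff_neg_smul_one_le_and_le_smul_one hnonneg.isSelfAdjoint (sq_nonneg t)
  rw [l2_opNorm_conjTranspose_mul_self, ← pow_two, sq_le_sq₀ (norm_nonneg M) ht] at this
  rw [this, and_iff_right hneg]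

variable [DecidableEq I]

theorem dilation_sq (M : Matrix I K ℝ) :
    dilation M ^ 2 = fromBlocks (M * Mᴴ) 0 0 (Mᴴ * M) := by
  simp only [pow_two, dilation_apply, fromBlocks_multiply, mul_zero, Matrix.zero_mul,
    Matrix.mul_zero, zero_add, add_zero]

theorem dilation_le_smul_one_iff (M : Matrix I K ℝ) {t : ℝ} (ht : 0 < t) :
    dilation M ≤ t • 1 ↔ ‖M‖ ≤ t := by
  have hone : (t • 1 : Matrix I I ℝ).PosDef := PosDef.one.smul ht
  let _ : Invertible (t • 1 : Matrix I I ℝ) := hone.isUnit.invertible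
  have hblocks : t • 1 - dilation M = fromBlocks (t • 1) (-M) (-M)ᴴ (t • 1) := by
    rw [dilation_apply, ← fromBlocks_one, fromBlocks_smul, sub_eq_add_neg, fromBlocks_neg,
      fromBlocks_add, conjTranspose_neg]
    simp only [smul_zero, neg_zero, add_zero, zero_add]
  have hinv : (t • 1 : Matrix I I ℝ)⁻¹ = t⁻¹ • 1 := inv_eq_right_inv <| by
    rw [smul_mul_smul_comm, mul_inv_cancel₀ ht.ne', mul_one, one_smul]
  have hschur : t • 1 - (-M)ᴴ * (t • 1 : Matrix I I ℝ)⁻¹ * -M = t⁻¹ • (t ^ 2 • 1 - Mᴴ * M) := by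
    rw [hinv, conjTranspose_neg, Matrix.mul_smul, Matrix.mul_one, smul_mul, Matrix.neg_mul,
      Matrix.mul_neg, neg_neg, smul_sub, smul_smul, pow_two, inv_mul_cancel_left₀ ht.ne']
  rw [le_iff, hblocks, PosDef.fromBlocks₁₁ _ _ hone, hschur, ← nonneg_iff_posSemidef,
    smul_nonneg_iff_nonneg_of_pos_left (inv_pos.2 ht), sub_nonneg,
    conjTranspose_mul_self_le_smul_one_iff M ht.le]

theorem norm_dilation_le (M : Matrix I K ℝ) : ‖dilation M‖ ≤ ‖M‖ := by
  refine le_of_forall_gt_imp_ge_of_dense fun t ht => ?_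
  have ht_pos : 0 < t := (norm_nonneg M).trans_lt ht
  rw [norm_le_iff_neg_smul_one_le_and_le_smul_one (isSelfAdjoint_dilation M) ht_pos.le,
    neg_le, ← map_neg, dilation_le_smul_one_iff _ ht_pos, dilation_le_smul_one_iff _ ht_pos,
    norm_neg, and_self]
  exact ht.le

theorem integral_fromBlocks_diagonal {S : Type*} [MeasurableSpace S] {P : Measure S}
    {A : S → Matrix I I ℝ} {D : S → Matrix K K ℝ} (hA : Integrable A P) (hD : Integrable D P) :
    ∫ s, fromBlocks (A s) 0 0 (D s) ∂P = fromBlocks (∫ s, A s ∂P) 0 0 (∫ s, D s ∂P) := by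
  let blockDiag : Matrix I I ℝ × Matrix K K ℝ →ₗ[ℝ] Matrix (I ⊕ K) (I ⊕ K) ℝ :=
    { toFun p := fromBlocks p.1 0 0 p.2
      map_add' p q := by simp [fromBlocks_add]
      map_smul' c p := by simp [fromBlocks_smul] }
  have h := (LinearMap.toContinuousLinearMap blockDiag).integral_comp_comm (hA.prodMk hD)
  rwa [integral_pair hA hD] at h

end Dilation

section RectangularBernstein

open Matrix
open scoped MatrixOrder Matrix.Norms.L2Operator

variable {I K : Type*} [Fintype I] [Fintype K] [DecidableEq I] [DecidableEq K]
  [MeasurableSpace (Matrix I K ℝ)] [BorelSpace (Matrix I K ℝ)]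
  {S : Type*} [MeasurableSpace S] {P : Measure S}

theorem integral_dilation_sq_le [IsFiniteMeasure P] {M : S → Matrix I K ℝ} (hmeas : Measurable M)
    {L : ℝ} (hL : ∀ s, ‖M s‖ ≤ L) {v : ℝ} (hrow : ∫ s, M s * (M s)ᴴ ∂P ≤ v • 1)
    (hcol : ∫ s, (M s)ᴴ * M s ∂P ≤ v • 1) : ∫ s, dilation (M s) ^ 2 ∂P ≤ v • 1 := by
  have hrow_int : Integrable (fun s => M s * (M s)ᴴ) P :=
    integrable_comp_of_norm_le (f := fun A => A * Aᴴ) (by fun_prop) hmeas hL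
  have hcol_int : Integrable (fun s => (M s)ᴴ * M s) P :=
    integrable_comp_of_norm_le (f := fun A => Aᴴ * A) (by fun_prop) hmeas hL
  simp only [dilation_sq]
  rw [integral_fromBlocks_diagonal hrow_int hcol_int]
  exact fromBlocks_diagonal_le_smul_one hrow hcol

theorem measureReal_lt_norm_sum_le_exp {ι : Type*} [Fintype ι] {M : ι → S → Matrix I K ℝ}
    (hindep : iIndepFun M P) (hmeas : ∀ k, Measurable (M k)) (hmean : ∀ k, ∫ s, M k s ∂P = 0)
    {L : ℝ} (hL : ∀ k s, ‖M k s‖ ≤ L) {v : ι → ℝ}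
    (hrow : ∀ k, ∫ s, M k s * (M k s)ᴴ ∂P ≤ v k • 1)
    (hcol : ∀ k, ∫ s, (M k s)ᴴ * M k s ∂P ≤ v k • 1)
    {θ : ℝ} (hθ : 0 < θ) (hθL : θ * L ≤ 1) {t : ℝ} (ht : 0 < t) :
    P.real {s | t < ‖∑ k, M k s‖} ≤
      (Fintype.card I + Fintype.card K) * Real.exp (θ ^ 2 * ∑ k, v k - θ * t) := by
  have : IsProbabilityMeasure P := hindep.isProbabilityMeasure
  borelize (Matrix (I ⊕ K) (I ⊕ K) ℝ)
  let dil := LinearMap.toContinuousLinearMap (dilation (I := I) (K := K))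
  have hM_int (k : ι) : Integrable (M k) P :=
    .of_bound (hmeas k).aestronglyMeasurable L (ae_of_all _ (hL k))
  calc P.real {s | t < ‖∑ k, M k s‖}
      = P.real {s | ¬ ∑ k, dilation (M k s) ≤ t • 1} := by
        simp only [← map_sum, dilation_le_smul_one_iff _ ht, not_le]
    _ ≤ Fintype.card (I ⊕ K) * Real.exp (θ ^ 2 * ∑ k, v k - θ * t) :=
        measureReal_not_sum_le_le_exp (hindep.comp _ fun _ => dil.measurable)
          (fun k => dil.measurable.comp (hmeas k)) (fun k s => isSelfAdjoint_dilation _)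
          (fun k => (dil.integral_comp_comm (hM_int k)).trans (by rw [hmean k, map_zero]))
          (fun k s => (norm_dilation_le _).trans (hL k s))
          (fun k => integral_dilation_sq_le (hmeas k) (hL k) (hrow k) (hcol k)) hθ hθL t
    _ = (Fintype.card I + Fintype.card K) * Real.exp (θ ^ 2 * ∑ k, v k - θ * t) := by
        rw [Fintype.card_sum, Nat.cast_add]

end RectangularBernstein

open ContinuousLinearMap in
theorem integral_star_mul_self_le {E : Type*} [NormedAddCommGroup E] [InnerProductSpace ℝ E]
    [CompleteSpace E] {S : Type*} [MeasurableSpace S] {P : Measure S} {T : S → E →L[ℝ] E}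
    (hT : Integrable (fun s => star (T s) * T s) P) {v : ℝ}
    (hv : ∀ x, ∫ s, ‖T s x‖ ^ 2 ∂P ≤ v * ‖x‖ ^ 2) : ∫ s, star (T s) * T s ∂P ≤ v • 1 := by
  have hsymm : IsSelfAdjoint (∫ s, star (T s) * T s ∂P) := by
    rw [IsSelfAdjoint]
    refine ((starL' ℝ (A := E →L[ℝ] E)).integral_comp_comm fun s => star (T s) * T s).symm.trans ?_
    simp only [starL'_apply, star_mul, star_star]
  rw [le_def, isPositive_iff']
  refine ⟨((IsSelfAdjoint.all v).smul (.one _)).sub hsymm, fun x => ?_⟩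
  have hquad : inner ℝ ((∫ s, star (T s) * T s ∂P) x) x = ∫ s, ‖T s x‖ ^ 2 ∂P := by
    rw [integral_apply hT, real_inner_comm, ← integral_inner (hT.apply_continuousLinearMap x)]
    simp only [mul_def, comp_apply, star_eq_adjoint, adjoint_inner_right,
      real_inner_self_eq_norm_sq]
  rw [sub_apply, inner_sub_left, hquad, smul_apply, one_def, id_apply, real_inner_smul_left,
    real_inner_self_eq_norm_sq, sub_nonneg]
  exact hv x

section EuclideanBernstein

open Matrix
open scoped MatrixOrder Matrix.Norms.L2Operator

variable {J : Type*} [Fintype J] [DecidableEq J] {S : Type*} [MeasurableSpace S] {P : Measure S}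

theorem toEuclideanCLM_le_toEuclideanCLM_iff {A B : Matrix J J ℝ} :
    toEuclideanCLM (𝕜 := ℝ) A ≤ toEuclideanCLM (𝕜 := ℝ) B ↔ A ≤ B := by
  rw [ContinuousLinearMap.le_def, ← map_sub, ← ContinuousLinearMap.isPositive_toLinearMap_iff,
    coe_toEuclideanCLM_eq_toEuclideanLin, isPositive_toEuclideanLin_iff, le_iff]

theorem integral_toEuclideanCLM (M : S → Matrix J J ℝ) :
    ∫ s, toEuclideanCLM (𝕜 := ℝ) (M s) ∂P = toEuclideanCLM (𝕜 := ℝ) (∫ s, M s ∂P) :=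
  (toEuclideanCLM (n := J) (𝕜 := ℝ)).toAlgEquiv.toLinearEquiv.toContinuousLinearEquiv
    |>.integral_comp_comm M

theorem continuous_toEuclideanCLM : Continuous (toEuclideanCLM (n := J) (𝕜 := ℝ)) :=
  (toEuclideanCLM (n := J) (𝕜 := ℝ)).toAlgEquiv.toLinearEquiv.toContinuousLinearEquiv.continuous

theorem continuous_toEuclideanCLM_symm : Continuous (toEuclideanCLM (n := J) (𝕜 := ℝ)).symm :=
  (toEuclideanCLM (n := J) (𝕜 := ℝ)).toAlgEquiv.toLinearEquiv.toContinuousLinearEquiv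
    |>.symm.continuous

theorem integral_conjTranspose_mul_self_le [MeasurableSpace (Matrix J J ℝ)]
    [BorelSpace (Matrix J J ℝ)] [IsFiniteMeasure P] {M : S → Matrix J J ℝ} (hmeas : Measurable M)
    {L : ℝ} (hL : ∀ s, ‖M s‖ ≤ L) {v : ℝ}
    (hv : ∀ x, ∫ s, ‖toEuclideanCLM (𝕜 := ℝ) (M s) x‖ ^ 2 ∂P ≤ v * ‖x‖ ^ 2) :
    ∫ s, (M s)ᴴ * M s ∂P ≤ v • 1 := by
  have hint : Integrable (fun s => toEuclideanCLM (𝕜 := ℝ) ((M s)ᴴ * M s)) P :=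
    integrable_comp_of_norm_le (f := fun A => toEuclideanCLM (𝕜 := ℝ) (Aᴴ * A))
      (continuous_toEuclideanCLM.comp (by fun_prop)) hmeas hL
  rw [← toEuclideanCLM_le_toEuclideanCLM_iff, ← integral_toEuclideanCLM, map_smul, map_one]
  simp only [← star_eq_conjTranspose, map_mul, map_star] at hint ⊢
  exact integral_star_mul_self_le hint hv

omit [DecidableEq J] in
theorem measureReal_lt_norm_sum_le
    {ι : Type*} [Fintype ι] {T : ι → S → EuclideanSpace ℝ J →L[ℝ] EuclideanSpace ℝ J}
    (hindep : iIndepFun T P) (hmeas : ∀ k, Measurable (T k)) (hmean : ∀ k, ∫ s, T k s ∂P = 0)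
    {L : ℝ} (hL : ∀ k s, ‖T k s‖ ≤ L) {v : ι → ℝ}
    (hrow : ∀ k x, ∫ s, ‖star (T k s) x‖ ^ 2 ∂P ≤ v k * ‖x‖ ^ 2)
    (hcol : ∀ k x, ∫ s, ‖T k s x‖ ^ 2 ∂P ≤ v k * ‖x‖ ^ 2)
    {t : ℝ} (ht : 0 < t) (hV : 0 < ∑ k, v k) (htL : t * L ≤ 2 * ∑ k, v k) :
    P.real {s | t < ‖∑ k, T k s‖} ≤
      2 * Fintype.card J * Real.exp (-(t ^ 2 / (4 * ∑ k, v k))) := by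
  classical
  have : IsProbabilityMeasure P := hindep.isProbabilityMeasure
  borelize (Matrix J J ℝ)
  set V := ∑ k, v k
  let M (k : ι) (s : S) : Matrix J J ℝ := (toEuclideanCLM (𝕜 := ℝ)).symm (T k s)
  have hTM (k : ι) (s : S) : T k s = toEuclideanCLM (𝕜 := ℝ) (M k s) :=
    (StarAlgEquiv.apply_symm_apply _ _).symm
  have hM_meas (k : ι) : Measurable (M k) :=
    (continuous_toEuclideanCLM_symm (J := J)).measurable.comp (hmeas k)
  have hM_indep : iIndepFun M P :=
    hindep.comp _ fun _ => (continuous_toEuclideanCLM_symm (J := J)).measurable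
  simp only [hTM, l2_opNorm_toEuclideanCLM, integral_toEuclideanCLM, ← map_star, ← map_sum,
    EmbeddingLike.map_eq_zero_iff] at hmean hL hrow hcol ⊢
  calc P.real {s | t < ‖∑ k, M k s‖}
      ≤ (Fintype.card J + Fintype.card J) * Real.exp ((t / (2 * V)) ^ 2 * V - t / (2 * V) * t) :=
        measureReal_lt_norm_sum_le_exp hM_indep hM_meas hmean hL
          (fun k => by
            simpa only [conjTranspose_conjTranspose] using!
              integral_conjTranspose_mul_self_le (continuous_star.measurable.comp (hM_meas k))
                (fun s => (norm_star _).trans_le (hL k s)) (hrow k))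
          (fun k => integral_conjTranspose_mul_self_le (hM_meas k) (hL k) (hcol k))
          (by positivity) (by rw [div_mul_eq_mul_div, div_le_one (by positivity)]; exact htL) ht
    _ = 2 * Fintype.card J * Real.exp (-(t ^ 2 / (4 * V))) := by
        rw [← two_mul]
        congr 2
        field_simp
        ring

end EuclideanBernstein

section CoordinateSampling

open ContinuousLinearMap InnerProductSpace

theorem integral_comp_of_map_eq_uniformOn_univ {J : Type*} [Fintype J] [MeasurableSpace J]
    [MeasurableSingletonClass J] {S : Type*} [MeasurableSpace S] {P : Measure S} {X : S → J}
    (hX : Measurable X) (hunif : P.map X = uniformOn Set.univ) {E : Type*} [NormedAddCommGroup E]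
    [NormedSpace ℝ E] [CompleteSpace E] (f : J → E) :
    ∫ s, f (X s) ∂P = (Fintype.card J : ℝ)⁻¹ • ∑ p, f p := by
  rw [← integral_map hX.aemeasurable (.of_discrete), hunif, integral_fintype .of_finite,
    Finset.smul_sum]
  refine Finset.sum_congr rfl fun p _ => ?_
  rw [measureReal_def, uniformOn_univ, Measure.count_singleton, one_div, ENNReal.toReal_inv,
    ENNReal.toReal_natCast]

variable {J : Type*} [Fintype J]

theorem sum_norm_sq_card_smul_sub_sum_le {E : Type*} [NormedAddCommGroup E]
    [InnerProductSpace ℝ E] (g : J → E) :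
    ∑ p, ‖(Fintype.card J : ℝ) • g p - ∑ q, g q‖ ^ 2 ≤
      (Fintype.card J : ℝ) ^ 2 * ∑ p, ‖g p‖ ^ 2 := by
  have hexpand (p : J) : ‖(Fintype.card J : ℝ) • g p - ∑ q, g q‖ ^ 2 =
      (Fintype.card J : ℝ) ^ 2 * ‖g p‖ ^ 2 - 2 * Fintype.card J * inner ℝ (g p) (∑ q, g q)
        + ‖∑ q, g q‖ ^ 2 := by
    rw [norm_sub_sq_real, norm_smul, real_inner_smul_left, Real.norm_natCast]
    ring
  have hnonneg : (0 : ℝ) ≤ Fintype.card J * ‖∑ q, g q‖ ^ 2 := by positivity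
  simp only [hexpand]
  rw [Finset.sum_add_distrib, Finset.sum_sub_distrib, ← Finset.mul_sum, ← Finset.mul_sum,
    ← sum_inner, real_inner_self_eq_norm_sq, Finset.sum_const, Finset.card_univ, nsmul_eq_mul]
  linarith

variable [DecidableEq J]

/-- The deviation from its mean `A ∘ B` of the operator `|J| A e_p e_pᵀ B`, where `p` is a uniformly
distributed coordinate and `B` is self-adjoint: the contribution of one sample `p` to the error
made when `A ∘ B` is replaced by `A ∘ P_Ω ∘ B`, up to the factor `1 / m`. -/
noncomputable def centredSample (A B : EuclideanSpace ℝ J →L[ℝ] EuclideanSpace ℝ J) (p : J) :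
    EuclideanSpace ℝ J →L[ℝ] EuclideanSpace ℝ J :=
  (Fintype.card J : ℝ) • rankOne ℝ (A (EuclideanSpace.single p 1)) (B (EuclideanSpace.single p 1))
    - A ∘L B

variable {A B : EuclideanSpace ℝ J →L[ℝ] EuclideanSpace ℝ J}

theorem inner_apply_single_left (hB : IsSelfAdjoint B) (p : J) (x : EuclideanSpace ℝ J) :
    inner ℝ (B (EuclideanSpace.single p 1)) x = B x p := by
  have h : inner ℝ (B (EuclideanSpace.single p 1)) x = inner ℝ (EuclideanSpace.single p 1) (B x) :=
    hB.isSymmetric _ _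
  rw [h, EuclideanSpace.inner_single_left, map_one, one_mul]

theorem sum_rankOne_apply_single (A : EuclideanSpace ℝ J →L[ℝ] EuclideanSpace ℝ J)
    (hB : IsSelfAdjoint B) :
    ∑ p, rankOne ℝ (A (EuclideanSpace.single p 1)) (B (EuclideanSpace.single p 1)) = A ∘L B := by
  ext1 x
  rw [sum_apply]
  simp only [rankOne_apply, inner_apply_single_left hB, ← map_smul, ← map_sum, comp_apply]
  congr 1
  simpa using (EuclideanSpace.basisFun J ℝ).sum_repr (B x)

theorem sum_centredSample (A : EuclideanSpace ℝ J →L[ℝ] EuclideanSpace ℝ J)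
    (hB : IsSelfAdjoint B) : ∑ p, centredSample A B p = 0 := by
  simp only [centredSample]
  rw [Finset.sum_sub_distrib, ← Finset.smul_sum, sum_rankOne_apply_single A hB, Finset.sum_const,
    Finset.card_univ, Nat.cast_smul_eq_nsmul, sub_self]

theorem star_centredSample (hA : IsSelfAdjoint A) (hB : IsSelfAdjoint B) (p : J) :
    star (centredSample A B p) = centredSample B A p := by
  rw [star_eq_adjoint, centredSample, centredSample, map_sub, LinearIsometryEquiv.map_smulₛₗ,
    adjoint_rankOne, adjoint_comp, hA.adjoint_eq, hB.adjoint_eq, conj_trivial]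

theorem norm_centredSample_le (hB : IsSelfAdjoint B) {a b : ℝ}
    (ha : ∀ p, ‖A (EuclideanSpace.single p 1)‖ ≤ a)
    (hb : ∀ p, ‖B (EuclideanSpace.single p 1)‖ ≤ b) (p : J) :
    ‖centredSample A B p‖ ≤ 2 * (Fintype.card J * (a * b)) := by
  have hrank (q : J) : ‖rankOne ℝ (A (EuclideanSpace.single q 1))
      (B (EuclideanSpace.single q 1))‖ ≤ a * b := by
    rw [norm_rankOne]
    exact mul_le_mul (ha q) (hb q) (norm_nonneg _) ((norm_nonneg _).trans (ha q))
  have hmean : ‖A ∘L B‖ ≤ Fintype.card J * (a * b) := by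
    rw [← sum_rankOne_apply_single A hB, ← nsmul_eq_mul, ← Finset.card_univ, ← Finset.sum_const]
    exact norm_sum_le_of_le _ fun q _ => hrank q
  rw [two_mul, centredSample]
  refine (norm_sub_le _ _).trans (add_le_add ?_ hmean)
  rw [norm_smul, Real.norm_natCast]
  gcongr
  exact hrank p

theorem sum_norm_sq_centredSample_apply_le (hB : IsSelfAdjoint B) (hB_norm : ‖B‖ ≤ 1) {a : ℝ}
    (ha : ∀ p, ‖A (EuclideanSpace.single p 1)‖ ≤ a) (x : EuclideanSpace ℝ J) :
    ∑ p, ‖centredSample A B p x‖ ^ 2 ≤ (Fintype.card J : ℝ) ^ 2 * a ^ 2 * ‖x‖ ^ 2 := by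
  have hBx : ‖B x‖ ≤ ‖x‖ := (B.le_of_opNorm_le hB_norm x).trans_eq (one_mul _)
  have hrank : ∑ p, ‖rankOne ℝ (A (EuclideanSpace.single p 1))
      (B (EuclideanSpace.single p 1)) x‖ ^ 2 ≤ a ^ 2 * ‖B x‖ ^ 2 := by
    rw [EuclideanSpace.real_norm_sq_eq, Finset.mul_sum]
    refine Finset.sum_le_sum fun p _ => ?_
    rw [rankOne_apply, inner_apply_single_left hB, norm_smul, mul_pow, Real.norm_eq_abs, sq_abs,
      mul_comm]
    gcongr
    exact ha p
  calc ∑ p, ‖centredSample A B p x‖ ^ 2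
      ≤ (Fintype.card J : ℝ) ^ 2 * ∑ p, ‖rankOne ℝ (A (EuclideanSpace.single p 1))
          (B (EuclideanSpace.single p 1)) x‖ ^ 2 := by
        have h := sum_norm_sq_card_smul_sub_sum_le fun p =>
          rankOne ℝ (A (EuclideanSpace.single p 1)) (B (EuclideanSpace.single p 1)) x
        rwa [← sum_apply, sum_rankOne_apply_single A hB] at h
    _ ≤ (Fintype.card J : ℝ) ^ 2 * (a ^ 2 * ‖x‖ ^ 2) := by
        gcongr
        exact hrank.trans (by gcongr)
    _ = (Fintype.card J : ℝ) ^ 2 * a ^ 2 * ‖x‖ ^ 2 := by ring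

theorem integral_norm_sq_centredSample_apply_le (hB : IsSelfAdjoint B) (hB_norm : ‖B‖ ≤ 1) {a : ℝ}
    (ha : ∀ p, ‖A (EuclideanSpace.single p 1)‖ ≤ a) [MeasurableSpace J]
    [MeasurableSingletonClass J] {S : Type*} [MeasurableSpace S] {P : Measure S} {X : S → J}
    (hX : Measurable X) (hunif : P.map X = uniformOn Set.univ) (x : EuclideanSpace ℝ J) :
    ∫ s, ‖centredSample A B (X s) x‖ ^ 2 ∂P ≤ Fintype.card J * a ^ 2 * ‖x‖ ^ 2 := by
  rw [integral_comp_of_map_eq_uniformOn_univ hX hunif fun p => ‖centredSample A B p x‖ ^ 2,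
    smul_eq_mul]
  calc (Fintype.card J : ℝ)⁻¹ * ∑ p, ‖centredSample A B p x‖ ^ 2
      ≤ (Fintype.card J : ℝ)⁻¹ * ((Fintype.card J : ℝ) ^ 2 * a ^ 2 * ‖x‖ ^ 2) := by
        gcongr
        exact sum_norm_sq_centredSample_apply_le hB hB_norm ha x
    _ = Fintype.card J * a ^ 2 * ‖x‖ ^ 2 := by
        rcases eq_or_ne (Fintype.card J : ℝ) 0 with h | h
        · simp only [h, inv_zero, zero_mul]
        · field_simp

theorem measureReal_lt_norm_smul_sum_centredSample_le (hA : IsSelfAdjoint A) (hB : IsSelfAdjoint B)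
    (hA_norm : ‖A‖ ≤ 1) (hB_norm : ‖B‖ ≤ 1) {a b L : ℝ}
    (ha : ∀ p, ‖A (EuclideanSpace.single p 1)‖ ≤ a)
    (hb : ∀ p, ‖B (EuclideanSpace.single p 1)‖ ≤ b)
    (haL : Fintype.card J * a ^ 2 ≤ L) (hbL : Fintype.card J * b ^ 2 ≤ L)
    (habL : 2 * (Fintype.card J * (a * b)) ≤ L) (hL : 0 < L)
    [MeasurableSpace J] [MeasurableSingletonClass J] {S : Type*} [MeasurableSpace S]
    {P : Measure S} {m : ℕ} (hm : 0 < m) {ω : Fin m → S → J} (hindep : iIndepFun ω P)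
    (hmeas : ∀ k, Measurable (ω k)) (hunif : ∀ k, P.map (ω k) = uniformOn Set.univ)
    {τ : ℝ} (hτ : 0 < τ) (hτ_le : τ ≤ 2) :
    P.real {s | τ < ‖(m : ℝ)⁻¹ • ∑ k, centredSample A B (ω k s)‖} ≤
      2 * Fintype.card J * Real.exp (-(m * τ ^ 2 / (4 * L))) := by
  have hm_pos : (0 : ℝ) < m := Nat.cast_pos.2 hm
  have hV : ∑ _k : Fin m, L = m * L := by
    rw [Finset.sum_const, Finset.card_univ, Fintype.card_fin, nsmul_eq_mul]
  have hset : {s | τ < ‖(m : ℝ)⁻¹ • ∑ k, centredSample A B (ω k s)‖} =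
      {s | m * τ < ‖∑ k, centredSample A B (ω k s)‖} := by
    ext s
    rw [Set.mem_ofPred, Set.mem_ofPred, norm_smul, Real.norm_of_nonneg (inv_nonneg.2 hm_pos.le),
      inv_mul_eq_div, lt_div_iff₀' hm_pos]
  have hbernstein : P.real {s | m * τ < ‖∑ k, centredSample A B (ω k s)‖} ≤
      2 * Fintype.card J * Real.exp (-((m * τ) ^ 2 / (4 * ∑ _k : Fin m, L))) := by
    refine measureReal_lt_norm_sum_le (T := fun k s => centredSample A B (ω k s)) (L := L)
      (hindep.comp (fun _ => centredSample A B) fun _ => .of_discrete)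
      (fun k => (Measurable.of_discrete (f := centredSample A B)).comp (hmeas k)) (fun k => ?_)
      (fun k s => (norm_centredSample_le hB ha hb _).trans habL) (fun k x => ?_) (fun k x => ?_)
      (by positivity) (by rw [hV]; positivity) ?_
    · rw [integral_comp_of_map_eq_uniformOn_univ (hmeas k) (hunif k), sum_centredSample A hB,
        smul_zero]
    · simp only [star_centredSample hA hB]
      exact (integral_norm_sq_centredSample_apply_le hA hA_norm hb (hmeas k) (hunif k) x).trans
        (by gcongr)
    · exact (integral_norm_sq_centredSample_apply_le hB hB_norm ha (hmeas k) (hunif k) x).trans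
        (by gcongr)
    · rw [hV]
      calc m * τ * L ≤ m * 2 * L := by gcongr
        _ = 2 * (m * L) := by ring
  rw [hset]
  refine hbernstein.trans_eq ?_
  rw [hV]
  congr 3
  field_simp

end CoordinateSampling

section StarProjection

open ContinuousLinearMap

variable {E : Type*} [NormedAddCommGroup E] [InnerProductSpace ℝ E]

theorem norm_starProjection_sub_starProjection_le_one (K L : Submodule ℝ E)
    [K.HasOrthogonalProjection] [L.HasOrthogonalProjection] :
    ‖K.starProjection - L.starProjection‖ ≤ 1 := by
  refine opNorm_le_bound _ zero_le_one fun x => ?_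
  rw [one_mul, ← sq_le_sq₀ (norm_nonneg _) (norm_nonneg x)]
  have hdecomp : (K.starProjection - L.starProjection) x =
      K.starProjection (Lᗮ.starProjection x) - Kᗮ.starProjection (L.starProjection x) := by
    simp only [Submodule.starProjection_orthogonal, sub_apply, id_apply, map_sub]
    abel
  have horth : inner ℝ (K.starProjection (Lᗮ.starProjection x))
      (Kᗮ.starProjection (L.starProjection x)) = 0 :=
    Submodule.inner_right_of_mem_orthogonal (K.starProjection_apply_mem _)
      (Kᗮ.starProjection_apply_mem _)
  calc ‖(K.starProjection - L.starProjection) x‖ ^ 2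
      = ‖K.starProjection (Lᗮ.starProjection x)‖ ^ 2 +
          ‖Kᗮ.starProjection (L.starProjection x)‖ ^ 2 := by
        rw [hdecomp, norm_sub_sq_real, horth, mul_zero, sub_zero]
    _ ≤ ‖Lᗮ.starProjection x‖ ^ 2 + ‖L.starProjection x‖ ^ 2 := by
        gcongr <;> exact Submodule.norm_starProjection_apply_le _ _
    _ = ‖x‖ ^ 2 := by rw [add_comm, ← L.norm_sq_eq_add_norm_sq_starProjection]

theorem norm_sub_le_one_of_isStarProjection [CompleteSpace E] {P Q : E →L[ℝ] E}
    (hP : IsStarProjection P) (hQ : IsStarProjection Q) : ‖P - Q‖ ≤ 1 := by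
  obtain ⟨K, _, rfl⟩ := isStarProjection_iff_eq_starProjection.1 hP
  obtain ⟨L, _, rfl⟩ := isStarProjection_iff_eq_starProjection.1 hQ
  exact norm_starProjection_sub_starProjection_le_one K L

theorem norm_sq_starProjection_le_of_mem_orthogonal (T : Submodule ℝ E)
    [T.HasOrthogonalProjection] (e : E) {f : E} (hf : f ∈ Tᗮ) :
    ‖T.starProjection e‖ ^ 2 ≤ ‖e - f‖ ^ 2 := by
  have h : T.starProjection (e - f) = T.starProjection e := by
    rw [map_sub, (Submodule.starProjection_apply_eq_zero_iff T).2 hf, sub_zero]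
  rw [← h]
  gcongr
  exact T.norm_starProjection_apply_le _

end StarProjection

section FrobeniusOperators

open ContinuousLinearMap InnerProductSpace
open scoped Matrix

variable {n : ℕ}

/-- The `j`-th column of a matrix. -/
def frobCol (Z : FrobMat n) (j : Fin n) : EuclideanSpace ℝ (Fin n) :=
  WithLp.toLp 2 fun i => Z (i, j)

/-- The rank one matrix `x yᵀ`. -/
def outerProd (x y : EuclideanSpace ℝ (Fin n)) : FrobMat n :=
  WithLp.toLp 2 fun p => x p.1 * y p.2

theorem frobCol_colProjOp {k : ℕ} (U : Matrix (Fin n) (Fin k) ℝ) (Z : FrobMat n) (j : Fin n) :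
    frobCol (colProjOp U Z) j = vecProj U (frobCol Z j) := rfl

theorem frobCol_outerProd (x y : EuclideanSpace ℝ (Fin n)) (j : Fin n) :
    frobCol (outerProd x y) j = y j • x := by
  ext i
  exact mul_comm _ _

theorem frobMat_ext {Z W : FrobMat n} (h : ∀ j, frobCol Z j = frobCol W j) : Z = W := by
  ext ⟨i, j⟩
  exact congrArg (fun x : EuclideanSpace ℝ (Fin n) => x i) (h j)

theorem inner_eq_sum_inner_frobCol (Z W : FrobMat n) :
    inner ℝ Z W = ∑ j, inner ℝ (frobCol Z j) (frobCol W j) := by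
  simp only [PiLp.inner_apply, frobCol]
  rw [Fintype.sum_prod_type_right]

theorem outerProd_single (p : Fin n × Fin n) :
    outerProd (EuclideanSpace.single p.1 1) (EuclideanSpace.single p.2 1) =
      EuclideanSpace.single p 1 := by
  ext q
  simp only [outerProd, PiLp.single_apply, Prod.ext_iff, ite_and, mul_ite, mul_one, mul_zero]
  split_ifs <;> rfl

theorem inner_outerProd (x y x' y' : EuclideanSpace ℝ (Fin n)) :
    inner ℝ (outerProd x y) (outerProd x' y') = inner ℝ x x' * inner ℝ y y' := by
  simp only [inner_eq_sum_inner_frobCol, frobCol_outerProd, real_inner_smul_left,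
    real_inner_smul_right]
  rw [PiLp.inner_apply y y', Finset.mul_sum]
  refine Finset.sum_congr rfl fun j _ => ?_
  rw [RCLike.inner_apply, conj_trivial]
  ring

theorem norm_outerProd (x y : EuclideanSpace ℝ (Fin n)) : ‖outerProd x y‖ = ‖x‖ * ‖y‖ := by
  rw [← sq_eq_sq₀ (norm_nonneg _) (by positivity), mul_pow]
  simp only [← real_inner_self_eq_norm_sq, inner_outerProd]

theorem isStarProjection_colProjOp {k : ℕ} (U : Matrix (Fin n) (Fin k) ℝ) :
    IsStarProjection (colProjOp U) := by
  constructor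
  · ext1 Z
    refine frobMat_ext fun j => ?_
    rw [mul_def, comp_apply, frobCol_colProjOp, frobCol_colProjOp]
    exact DFunLike.congr_fun (colSpace U).isIdempotentElem_starProjection (frobCol Z j)
  · refine isSelfAdjoint_iff_isSymmetric.2 fun Z W => ?_
    simp only [coe_coe, inner_eq_sum_inner_frobCol, frobCol_colProjOp]
    exact Finset.sum_congr rfl fun j _ => (colSpace U).inner_starProjection_left_eq_right _ _

theorem colProjOp_outerProd {k : ℕ} (U : Matrix (Fin n) (Fin k) ℝ)
    (x y : EuclideanSpace ℝ (Fin n)) :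
    colProjOp U (outerProd x y) = outerProd (vecProj U x) y :=
  frobMat_ext fun j => by
    rw [frobCol_colProjOp, frobCol_outerProd, frobCol_outerProd, map_smul]

theorem norm_colProjOp_single {k : ℕ} (U : Matrix (Fin n) (Fin k) ℝ) (p : Fin n × Fin n) :
    ‖colProjOp U (EuclideanSpace.single p 1)‖ = ‖vecProj U (EuclideanSpace.single p.1 1)‖ := by
  rw [← outerProd_single, colProjOp_outerProd, norm_outerProd, PiLp.norm_single,
    norm_one, mul_one]

theorem inner_outerProd_left (x y : EuclideanSpace ℝ (Fin n)) (W : FrobMat n) :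
    inner ℝ (outerProd x y) W = x.ofLp ⬝ᵥ frobEquiv n W *ᵥ y.ofLp := by
  simp only [PiLp.inner_apply, RCLike.inner_apply, conj_trivial, dotProduct, Matrix.mulVec,
    Finset.mul_sum, Fintype.sum_prod_type]
  refine Finset.sum_congr rfl fun i _ => Finset.sum_congr rfl fun j _ => ?_
  change W (i, j) * (x i * y j) = x i * (W (i, j) * y j)
  ring

theorem vecMul_eq_zero_of_mem_colSpace_orthogonal {k : ℕ} {U : Matrix (Fin n) (Fin k) ℝ}
    {x : EuclideanSpace ℝ (Fin n)} (hx : x ∈ (colSpace U)ᗮ) : Matrix.vecMul x.ofLp U = 0 := by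
  refine dotProduct_eq_zero_iff.1 fun z => ?_
  rw [← Matrix.dotProduct_mulVec, dotProduct_comm]
  exact (Submodule.mem_orthogonal' _ _).1 hx _ ⟨WithLp.toLp 2 z, rfl⟩

theorem outerProd_mem_tangentSpace_orthogonal {r : ℕ} {U V : Matrix (Fin n) (Fin r) ℝ}
    {x y : EuclideanSpace ℝ (Fin n)} (hx : x ∈ (colSpace U)ᗮ) (hy : y ∈ (colSpace V)ᗮ) :
    outerProd x y ∈ (tangentSpace U V)ᗮ := by
  rw [Submodule.mem_orthogonal']
  rintro W ⟨Z₁, Z₂, hW⟩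
  rw [inner_outerProd_left, hW, Matrix.add_mulVec, dotProduct_add, ← Matrix.mulVec_mulVec,
    ← Matrix.mulVec_mulVec, Matrix.dotProduct_mulVec,
    vecMul_eq_zero_of_mem_colSpace_orthogonal hx, zero_dotProduct, Matrix.mulVec_transpose V,
    vecMul_eq_zero_of_mem_colSpace_orthogonal hy, Matrix.mulVec_zero, dotProduct_zero, add_zero]

theorem norm_sq_tangentProj_outerProd_le {r : ℕ} (U V : Matrix (Fin n) (Fin r) ℝ)
    (x y : EuclideanSpace ℝ (Fin n)) :
    ‖tangentProj U V (outerProd x y)‖ ^ 2 ≤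
      ‖vecProj U x‖ ^ 2 * ‖y‖ ^ 2 + ‖x‖ ^ 2 * ‖vecProj V y‖ ^ 2 := by
  set a := (colSpace U)ᗮ.starProjection x
  set b := (colSpace V)ᗮ.starProjection y
  have hx : ‖x‖ ^ 2 = ‖vecProj U x‖ ^ 2 + ‖a‖ ^ 2 :=
    (colSpace U).norm_sq_eq_add_norm_sq_starProjection x
  have hy : ‖y‖ ^ 2 = ‖vecProj V y‖ ^ 2 + ‖b‖ ^ 2 :=
    (colSpace V).norm_sq_eq_add_norm_sq_starProjection y
  have hax : inner ℝ x a = ‖a‖ ^ 2 := by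
    rw [real_inner_comm]
    exact (colSpace U)ᗮ.re_inner_starProjection_eq_normSq x
  have hby : inner ℝ y b = ‖b‖ ^ 2 := by
    rw [real_inner_comm]
    exact (colSpace V)ᗮ.re_inner_starProjection_eq_normSq y
  calc ‖tangentProj U V (outerProd x y)‖ ^ 2 ≤ ‖outerProd x y - outerProd a b‖ ^ 2 :=
        norm_sq_starProjection_le_of_mem_orthogonal _ _ <|
          outerProd_mem_tangentSpace_orthogonal (Submodule.starProjection_apply_mem _ _)
            (Submodule.starProjection_apply_mem _ _)
    _ = ‖x‖ ^ 2 * ‖y‖ ^ 2 - ‖a‖ ^ 2 * ‖b‖ ^ 2 := by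
        rw [norm_sub_sq_real, inner_outerProd, hax, hby, norm_outerProd, norm_outerProd]
        ring
    _ ≤ ‖vecProj U x‖ ^ 2 * ‖y‖ ^ 2 + ‖x‖ ^ 2 * ‖vecProj V y‖ ^ 2 := by
        have : 0 ≤ ‖vecProj U x‖ ^ 2 * ‖vecProj V y‖ ^ 2 := by positivity
        rw [hx, hy]
        linarith

theorem norm_sq_tangentProj_single_le {r : ℕ} (U V : Matrix (Fin n) (Fin r) ℝ)
    (p : Fin n × Fin n) :
    ‖tangentProj U V (EuclideanSpace.single p 1)‖ ^ 2 ≤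
      ‖vecProj U (EuclideanSpace.single p.1 1)‖ ^ 2 +
        ‖vecProj V (EuclideanSpace.single p.2 1)‖ ^ 2 := by
  simpa only [outerProd_single, PiLp.norm_single, norm_one, one_pow, mul_one, one_mul]
    using norm_sq_tangentProj_outerProd_le U V (EuclideanSpace.single p.1 1)
      (EuclideanSpace.single p.2 1)

theorem sampling_apply {m : ℕ} (ω : Fin m → Fin n × Fin n) (Z : FrobMat n) :
    sampling ω Z = ∑ k, Z (ω k) • EuclideanSpace.single (ω k) 1 := by
  ext p
  change Z p * (∑ k, Matrix.single (ω k).1 (ω k).2 (1 : ℝ)) p.1 p.2 = _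
  rw [Matrix.sum_apply, Finset.mul_sum, WithLp.ofLp_sum, Finset.sum_apply]
  refine Finset.sum_congr rfl fun k _ => ?_
  simp only [Matrix.single_apply, PiLp.smul_apply, PiLp.single_apply]
  by_cases h : p = ω k
  · simp [h]
  · rw [if_neg h, if_neg fun h' => h (Prod.ext h'.1.symm h'.2.symm), mul_zero, smul_zero]

theorem comp_sampling_comp {m : ℕ} (ω : Fin m → Fin n × Fin n) (A : FrobMat n →L[ℝ] FrobMat n)
    {B : FrobMat n →L[ℝ] FrobMat n} (hB : IsSelfAdjoint B) :
    A ∘L sampling ω ∘L B = ∑ k, rankOne ℝ (A (EuclideanSpace.single (ω k) 1))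
      (B (EuclideanSpace.single (ω k) 1)) := by
  ext1 x
  simp only [sum_apply, rankOne_apply, inner_apply_single_left hB, comp_apply, sampling_apply,
    map_sum, map_smul]

/-- The error `(n² / m) A P_Ω B - A B` made when `A B` is estimated from the entries sampled
by `Ω = (ω 1, …, ω m)`. -/
noncomputable def samplingError {m : ℕ} (A B : FrobMat n →L[ℝ] FrobMat n)
    (ω : Fin m → Fin n × Fin n) : FrobMat n →L[ℝ] FrobMat n :=
  ((n : ℝ) ^ 2 / m) • (A ∘L sampling ω ∘L B) - A ∘L B

theorem samplingError_zero_right {m : ℕ} (A : FrobMat n →L[ℝ] FrobMat n)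
    (ω : Fin m → Fin n × Fin n) : samplingError A 0 ω = 0 := by
  ext1 x
  simp [samplingError]

theorem samplingError_eq_smul_sum_centredSample {m : ℕ} (hm : 0 < m) (ω : Fin m → Fin n × Fin n)
    (A : FrobMat n →L[ℝ] FrobMat n) {B : FrobMat n →L[ℝ] FrobMat n} (hB : IsSelfAdjoint B) :
    samplingError A B ω = (m : ℝ)⁻¹ • ∑ k, centredSample A B (ω k) := by
  have hm_ne : (m : ℝ) ≠ 0 := Nat.cast_ne_zero.2 hm.ne'
  have hcard : (Fintype.card (Fin n × Fin n) : ℝ) = n ^ 2 := by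
    rw [Fintype.card_prod, Fintype.card_fin, Nat.cast_mul, pow_two]
  simp only [samplingError, centredSample]
  rw [comp_sampling_comp ω A hB, Finset.sum_sub_distrib, ← Finset.smul_sum, Finset.sum_const,
    Finset.card_univ, Fintype.card_fin, hcard, smul_sub, smul_smul, ← Nat.cast_smul_eq_nsmul ℝ,
    smul_smul, inv_mul_cancel₀ hm_ne, one_smul, inv_mul_eq_div]

end FrobeniusOperators

section Sampling

variable {n r k : ℕ} {μ : ℝ} {Ul Vl : Matrix (Fin n) (Fin r) ℝ} {U : Matrix (Fin n) (Fin k) ℝ}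

theorem norm_tangentProj_single_le (hμ : 0 ≤ μ) (hinc : IsIncoherent μ Ul Vl)
    (p : Fin n × Fin n) :
    ‖tangentProj Ul Vl (EuclideanSpace.single p 1)‖ ≤ √2 * √(μ * r / n) := by
  rw [← Real.sqrt_mul zero_le_two]
  refine Real.le_sqrt_of_sq_le ((norm_sq_tangentProj_single_le Ul Vl p).trans ?_)
  have hq : 0 ≤ μ * r / n := by positivity
  rw [two_mul]
  exact add_le_add ((Real.le_sqrt (norm_nonneg _) hq).1 (hinc.1 p.1))
    ((Real.le_sqrt (norm_nonneg _) hq).1 (hinc.2 p.2))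

theorem norm_colProjOp_sub_single_le {κ : ℝ}
    (hU : ∀ i, ‖vecProj U (EuclideanSpace.single i 1)‖ ≤ κ)
    (hUl : ∀ i, ‖vecProj Ul (EuclideanSpace.single i 1)‖ ≤ κ) (p : Fin n × Fin n) :
    ‖(colProjOp U - colProjOp Ul) (EuclideanSpace.single p 1)‖ ≤ 2 * κ := by
  rw [two_mul, sub_apply]
  refine (norm_sub_le _ _).trans (add_le_add ?_ ?_) <;> rw [norm_colProjOp_single]
  exacts [hU p.1, hUl p.1]

theorem isSelfAdjoint_colProjOp_sub_colProjOp :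
    IsSelfAdjoint (colProjOp U - colProjOp Ul) :=
  IsSelfAdjoint.sub (R := FrobMat n →L[ℝ] FrobMat n) (isStarProjection_colProjOp U).isSelfAdjoint
    (isStarProjection_colProjOp Ul).isSelfAdjoint

theorem colProjOp_sub_colProjOp_eq_zero
    (hU : ∀ i, ‖vecProj U (EuclideanSpace.single i 1)‖ ≤ 0)
    (hUl : ∀ i, ‖vecProj Ul (EuclideanSpace.single i 1)‖ ≤ 0) :
    colProjOp U - colProjOp Ul = 0 := by
  refine ContinuousLinearMap.coe_injective
    ((EuclideanSpace.basisFun (Fin n × Fin n) ℝ).toBasis.ext fun p => ?_)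
  rw [OrthonormalBasis.coe_toBasis, EuclideanSpace.basisFun_apply]
  exact norm_le_zero_iff.1 ((norm_colProjOp_sub_single_le hU hUl p).trans_eq (mul_zero 2))

variable {S : Type*} [MeasurableSpace S] {P : Measure S} {m : ℕ} {ω : Fin m → S → Fin n × Fin n}

theorem IsUniformSample.measureReal_lt_norm_samplingError_le
    (hω : IsUniformSample P ω) (hinc : IsIncoherent μ Ul Vl)
    (hU : ∀ i, ‖vecProj U (EuclideanSpace.single i 1)‖ ≤ √(μ * r / n))
    (hm : 0 < m) (hK : 0 < μ * r * n) {τ : ℝ} (hτ : 0 < τ) (hτ_le : τ ≤ 2) :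
    P.real {s | τ <
        ‖samplingError (tangentProj Ul Vl) (colProjOp U - colProjOp Ul) (fun k => ω k s)‖} ≤
      2 * (n : ℝ) ^ 2 * Real.exp (-(m * τ ^ 2 / (4 * (6 * (μ * r * n))))) := by
  have hn : (0 : ℝ) < n := (Nat.cast_nonneg n).lt_of_ne' (right_ne_zero_of_mul hK.ne')
  have hμ : 0 < μ := pos_of_mul_pos_left (mul_assoc μ r n ▸ hK) (by positivity)
  set κ : ℝ := √(μ * r / n)
  have hcard : (Fintype.card (Fin n × Fin n) : ℝ) = n ^ 2 := by
    rw [Fintype.card_prod, Fintype.card_fin, Nat.cast_mul, pow_two]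
  have hκ : (n : ℝ) ^ 2 * κ ^ 2 = μ * r * n := by
    rw [Real.sq_sqrt (by positivity)]
    field_simp
  have hsqrt_two : √(2 : ℝ) ≤ 3 / 2 := Real.sqrt_le_iff.2 (by norm_num)
  simp only [samplingError_eq_smul_sum_centredSample hm _ _
    isSelfAdjoint_colProjOp_sub_colProjOp]
  rw [← hcard]
  refine measureReal_lt_norm_smul_sum_centredSample_le (isSelfAdjoint_starProjection _)
    isSelfAdjoint_colProjOp_sub_colProjOp (Submodule.starProjection_norm_le _)
    (norm_sub_le_one_of_isStarProjection (isStarProjection_colProjOp U)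
      (isStarProjection_colProjOp Ul))
    (norm_tangentProj_single_le hμ.le hinc) (norm_colProjOp_sub_single_le hU hinc.1) ?_ ?_ ?_
    (by positivity) hm hω.indep hω.measurable hω.uniform hτ hτ_le <;> rw [hcard]
  · calc (n : ℝ) ^ 2 * (√2 * κ) ^ 2 = √2 ^ 2 * ((n : ℝ) ^ 2 * κ ^ 2) := by ring
      _ = 2 * (μ * r * n) := by rw [hκ, Real.sq_sqrt zero_le_two]
      _ ≤ 6 * (μ * r * n) := by gcongr; norm_num
  · calc (n : ℝ) ^ 2 * (2 * κ) ^ 2 = 4 * ((n : ℝ) ^ 2 * κ ^ 2) := by ring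
      _ ≤ 6 * (μ * r * n) := by rw [hκ]; gcongr; norm_num
  · calc 2 * ((n : ℝ) ^ 2 * (√2 * κ * (2 * κ))) = 4 * √2 * ((n : ℝ) ^ 2 * κ ^ 2) := by ring
      _ ≤ 6 * (μ * r * n) := by rw [hκ]; gcongr; linarith

theorem sq_mul_exp_neg_eq_rpow {β K τ : ℝ} (hn : 0 < n) (hm : 0 < m) (hK : 0 < K)
    (hτ : τ ^ 2 = 48 * β * K * Real.log n / m) :
    2 * (n : ℝ) ^ 2 * Real.exp (-(m * τ ^ 2 / (4 * (6 * K)))) = 2 * (n : ℝ) ^ (2 - 2 * β) := by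
  have hexponent : -(m * τ ^ 2 / (4 * (6 * K))) = Real.log n * (-(2 * β)) := by
    rw [hτ]
    field_simp
    ring
  rw [hexponent, ← Real.rpow_def_of_pos (Nat.cast_pos.2 hn), sub_eq_add_neg,
    Real.rpow_add (Nat.cast_pos.2 hn), Real.rpow_two, mul_assoc]

theorem IsUniformSample.measureReal_sqrt_lt_norm_samplingError_le {β : ℝ}
    (hω : IsUniformSample P ω) (hinc : IsIncoherent μ Ul Vl)
    (hU : ∀ i, ‖vecProj U (EuclideanSpace.single i 1)‖ ≤ √(μ * r / n))
    (hβ : 0 < β) (hn : 1 < n) (hK : 0 < μ * r * n)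
    (hm : 15 * β * μ * n * r * Real.log n ≤ m) :
    P.real {s | √(48 * β * μ * n * r * Real.log n / m) <
        ‖samplingError (tangentProj Ul Vl) (colProjOp U - colProjOp Ul) (fun k => ω k s)‖} ≤
      2 * (n : ℝ) ^ (2 - 2 * β) := by
  have hlog : 0 < Real.log n := Real.log_pos (Nat.one_lt_cast.2 hn)
  have hnum : 0 < β * (μ * r * n) * Real.log n := by positivity
  have hm_pos : (0 : ℝ) < m := by linarith
  set τ := √(48 * β * μ * n * r * Real.log n / m)
  have hτ_sq : τ ^ 2 = 48 * β * (μ * r * n) * Real.log n / m := by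
    rw [Real.sq_sqrt (div_nonneg (by linarith) hm_pos.le)]
    ring
  have hτ_pos : 0 < τ := Real.sqrt_pos.2 (div_pos (by linarith) hm_pos)
  have hτ_le : τ ≤ 2 := Real.sqrt_le_iff.2 ⟨zero_le_two, (div_le_iff₀ hm_pos).2 (by linarith)⟩
  exact (hω.measureReal_lt_norm_samplingError_le hinc hU (Nat.cast_pos.1 hm_pos) hK hτ_pos
    hτ_le).trans_eq
      (sq_mul_exp_neg_eq_rpow (zero_lt_one.trans hn) (Nat.cast_pos.1 hm_pos) hK hτ_sq)

theorem one_sub_le_measureReal_of_measureReal_compl_le [IsProbabilityMeasure P] {s : Set S} {δ : ℝ}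
    (h : P.real sᶜ ≤ δ) : 1 - δ ≤ P.real s := by
  have hunion : 1 ≤ P.real s + P.real sᶜ := by
    rw [← probReal_univ (μ := P), ← Set.union_compl_self s]
    exact measureReal_union_le s sᶜ
  linarith

end Sampling

end MatrixCompletion

open MatrixCompletion in
theorem mainTheorem6_general {n r k m : ℕ} {μ β : ℝ} (hμ : 0 < μ) (hβ : 0 < β)
    {Ul Vl : Matrix (Fin n) (Fin r) ℝ} {U : Matrix (Fin n) (Fin k) ℝ}
    (hinc : IsIncoherent μ Ul Vl)
    (hU : ∀ i, ‖vecProj U (EuclideanSpace.single i 1)‖ ≤ √(μ * r / n))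
    {S : Type*} [MeasurableSpace S] {P : Measure S} [IsProbabilityMeasure P]
    {ω : Fin m → S → Fin n × Fin n} (hω : IsUniformSample P ω)
    (hm : 15 * β * μ * n * r * Real.log n ≤ m) :
    1 - 2 * (n : ℝ) ^ (2 - 2 * β) ≤
      P.real {s | ‖((n : ℝ) ^ 2 / m) • (tangentProj Ul Vl ∘L sampling (fun k => ω k s) ∘L
          (colProjOp U - colProjOp Ul)) - tangentProj Ul Vl ∘L (colProjOp U - colProjOp Ul)‖ ≤
        √(48 * β * μ * n * r * Real.log n / m)} := by
  change _ ≤ P.real {s | ‖samplingError _ _ fun k => ω k s‖ ≤ _}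
  rcases (show 0 ≤ μ * r * n by positivity).eq_or_lt with hK | hK
  · have hκ : √(μ * r / n) = 0 := by
      rcases mul_eq_zero.1 hK.symm with h | h <;> simp only [h, zero_div, div_zero, Real.sqrt_zero]
    have hB := colProjOp_sub_colProjOp_eq_zero (fun i => hκ ▸ hU i) (fun i => hκ ▸ hinc.1 i)
    simp only [hB, samplingError_zero_right, norm_zero, Real.sqrt_nonneg, Set.ofPred_true,
      probReal_univ]
    linarith [Real.rpow_nonneg (Nat.cast_nonneg (α := ℝ) n) (2 - 2 * β)]
  rcases lt_or_ge 1 n with hn | hn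
  · refine one_sub_le_measureReal_of_measureReal_compl_le ?_
    simpa only [Set.compl_ofPred, not_le] using
      hω.measureReal_sqrt_lt_norm_samplingError_le hinc hU hβ hn hK hm
  · have hn_ne : n ≠ 0 := Nat.cast_ne_zero.1 (right_ne_zero_of_mul hK.ne')
    obtain rfl : n = 1 := by omega
    refine le_trans ?_ measureReal_nonneg
    norm_num

theorem mainTheorem6 {n r m : ℕ} {μ β : ℝ} (hμ : 0 < μ) (hβ : 1 < β)
    (X Xl : Matrix (Fin n) (Fin n) ℝ)
    (U V Ul Vl : Matrix (Fin n) (Fin r) ℝ) (σ σl : Fin r → ℝ)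
    (hX : MatrixCompletion.IsReducedSVD X U σ V)
    (hXl : MatrixCompletion.IsReducedSVD Xl Ul σl Vl)
    (hincl : MatrixCompletion.IsIncoherent μ Ul Vl)
    (hinc : MatrixCompletion.IsIncoherent μ U V)
    {S : Type*} [MeasurableSpace S] (P : MeasureTheory.Measure S)
    [MeasureTheory.IsProbabilityMeasure P]
    (ω : Fin m → S → Fin n × Fin n) (hω : MatrixCompletion.IsUniformSample P ω)
    (hm : 15 * β * μ * n * r * Real.log n ≤ (m : ℝ)) :
    1 - 2 * (n : ℝ) ^ (2 - 2 * β) ≤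
      P.real {s | ‖((n : ℝ) ^ 2 / (m : ℝ)) •
            (MatrixCompletion.tangentProj Ul Vl ∘L MatrixCompletion.sampling (fun k => ω k s) ∘L
              (MatrixCompletion.colProjOp U - MatrixCompletion.colProjOp Ul)) -
          MatrixCompletion.tangentProj Ul Vl ∘L
            (MatrixCompletion.colProjOp U - MatrixCompletion.colProjOp Ul)‖
        ≤ √(48 * β * μ * n * r * Real.log n / m)} :=
  mainTheorem6_general hμ (zero_lt_one.trans hβ) hincl hinc.1 hω hm
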